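/- Let $k$ be a field, let $H$ be a finite group acting by automorphisms on a group $\Gamma$ (written $h.r$), let $k^H$ be the Hopf algebra of functions on $H$ with basis $(\delta_h)_{h\in H}$, and let $k[\Gamma]\rtimes k^H$ be the smash coproduct Hopf algebra: it is $k[\Gamma]\otimes k^H$ as an algebra, with $$\Delta(r\#\delta_h)=\sum_{l\in H}r\#\delta_{l^{-1}}\otimes l.r\#\delta_{lh},\quad \varepsilon(r\#\delta_h)=\delta_{h,1},\quad S(r\#\delta_h)=h^{-1}.r^{-1}\#\delta_{h^{-1}}.$$ A factorization of an algebra map $\rho:A\to R$ from a Hopf algebra $A$ to an algebra $R$ is a triple $(L,q,\varphi)$ with $L$ a Hopf algebra, $q:A\to L$ a surjective Hopf algebra map and $\varphi:L\to R$ an algebra map with $\varphi q=\rho$. The Hopf image of $\rho$ is the final factorization: a factorization $(A_\rho,p,\tilde\rho)$ such that for every factorization $(L,q,\varphi)$ there is a unique Hopf algebra map $f:L\to A_\rho$ with $fq=p$ and $\tilde\rho f=\varphi$. The map $\rho$ is inner faithful if $(A,\mathrm{id}_A,\rho)$ is the Hopf image of $\rho$. A quotient datum $(N,\Phi)$ consists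 of a normal $H$-stable subgroup $N$ of $\Gamma$ and a group morphism $\Phi:N\to(k^H)^\times$ with $\Phi(r)(lh)=\Phi(l^{-1}.r)(h)\,\Phi(r)(l)$ and $\Phi(srs^{-1})=\Phi(r)$ for $r\in N$, $s\in\Gamma$, $h,l\in H$. Let $u:\Gamma\to\Gamma/N$ be the projection. Given a section $j$ of $u$ with $ju(1)=1$, the Hopf algebra $k[\Gamma/N]\rtimes_\Phi k^H$ is $k[\Gamma/N]\otimes k^H$ with unit $1\#1$, counit $\varepsilon(u(r)\#\delta_h)=\delta_{h,1}$, and $$(u(r)\#\delta_h)(u(s)\#\delta_l)=u(rs)\#\delta_h\delta_l\,\Phi(ju(r)ju(s)ju(rs)^{-1}),$$ $$\Delta(u(r)\#\delta_h)=\sum_{l\in H}(u(r)\#\delta_{l^{-1}})\otimes \big(u(l.r)\#\delta_{lh}\,\Phi((l.ju(r))\,ju(l.r)^{-1})\big),$$ $$S(u(r)\#\delta_h)=u(h^{-1}.r^{-1})\#\Phi\big(ju(h^{-1}.r^{-1})^{-1}\,(h^{-1}.ju(r)^{-1})\big)\delta_{h^{-1}}.$$ Let $R$ be a $k$-algebra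 and let $\rho:k[\Gamma]\rtimes k^H\to R$ be an algebra map whose restriction to $k^H$ is inner faithful. Let $\mathcal E(\rho)$ be the set of quotient data $(N,\Phi)$ with $\rho(r\#1)=\rho(1\#\Phi(r))$ for all $r\in N$, partially ordered by $(N,\Phi)\le(M,\Psi)\iff N\subset M$ and $\Psi_{|N}=\Phi$. Then: 1. For every $(N,\Phi)\in\mathcal E(\rho)$ and every section $j$ as above, there is a factorization $\rho=\tilde\rho q$ through $k[\Gamma/N]\rtimes_\Phi k^H$, with $q(r\#\delta_h)=u(r)\#\delta_h\Phi(r\,ju(r)^{-1})$ a surjective Hopf algebra map and $\tilde\rho(u(r)\#\delta_h)=\rho(ju(r)\#\delta_h)$ an algebra map. 2. $\mathcal E(\rho)$ has a maximal element. 3. For every maximal $(N,\Phi)\in\mathcal E(\rho)$ and every such $j$, the factorization in 1 is universal: $(k[\Gamma/N]\rtimes_\Phi k^H,q,\tilde\rho)$ is the Hopf image of $\rho$. -/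

import Mathlib

open scoped TensorProduct

universe w

noncomputable section

/-- The underlying vector space `k^H` of functions on `H`. -/
def FunAlg (k H : Type*) : Type _ := H → k

namespace FunAlg

variable {k H : Type*} [Field k]

instance : CommRing (FunAlg k H) := inferInstanceAs (CommRing (H → k))
instance : Algebra k (FunAlg k H) := inferInstanceAs (Algebra k (H → k))

/-- The element of `k^H` given by a function. -/
def mk {k H : Type*} (f : H → k) : FunAlg k H := f

/-- The value of an element of `k^H` at a point. -/
def eval {k H : Type*} (f : FunAlg k H) (x : H) : k := f x

instance {k H : Type*} : CoeFun (FunAlg k H) (fun _ => H → k) := ⟨eval⟩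

@[ext] theorem ext {k H : Type*} {f g : FunAlg k H} (h : ∀ x : H, f x = g x) : f = g := funext h
@[simp] theorem mk_apply {k H : Type*} (f : H → k) (x : H) : mk f x = f x := rfl
@[simp] theorem zero_apply (x : H) : (0 : FunAlg k H) x = 0 := rfl
@[simp] theorem mul_apply (f g : FunAlg k H) (x : H) : (f * g) x = f x * g x := rfl
@[simp] theorem add_apply (f g : FunAlg k H) (x : H) : (f + g) x = f x + g x := rfl
@[simp] theorem one_apply (x : H) : (1 : FunAlg k H) x = 1 := rfl
@[simp] theorem smul_apply (c : k) (f : FunAlg k H) (x : H) : (c • f) x = c * f x := rfl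

section Delta

variable [DecidableEq H]

/-- The function `δ_h`, equal to `1` at `h` and to `0` elsewhere. -/
def delta (k : Type*) [Field k] {H : Type*} [DecidableEq H] (h : H) : FunAlg k H :=
  mk fun x => if x = h then 1 else 0

@[simp] theorem delta_apply (h x : H) : delta k h x = if x = h then 1 else 0 := rfl

@[simp] theorem delta_mul (h l : H) :
    delta k h * delta k l = if h = l then delta k h else 0 := by
  ext x
  by_cases hl : h = l
  · subst hl; simp
  · simp only [hl, if_false, mul_apply, delta_apply]
    rw [zero_apply]
    split_ifs <;> simp_all

variable [Fintype H]

theorem eq_sum (f : FunAlg k H) : f = ∑ h : H, f h • delta k h := by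
  ext x
  let ev : FunAlg k H →ₗ[k] k :=
    { toFun := fun g => g x, map_add' := fun _ _ => rfl, map_smul' := fun _ _ => rfl }
  have hev : ∀ g : FunAlg k H, ev g = g x := fun _ => rfl
  rw [← hev (∑ h : H, f h • delta k h), map_sum, Finset.sum_eq_single x]
  · simp [hev]
  · intro b _ hb
    simp [hev, Ne.symm hb]
  · simp

theorem lin_ext {M : Type*} [AddCommMonoid M] [Module k M] {φ ψ : FunAlg k H →ₗ[k] M}
    (h : ∀ x, φ (delta k x) = ψ (delta k x)) : φ = ψ := by
  ext f
  rw [eq_sum f]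
  simp [h]

theorem sum_delta : ∑ h : H, delta k h = 1 := by
  have := eq_sum (1 : FunAlg k H)
  simpa using this.symm

end Delta

section Hopf

variable [Group H]

/-- The counit `f ↦ f(1)`. -/
def counitLin (k H : Type*) [Field k] [Group H] : FunAlg k H →ₗ[k] k where
  toFun f := f 1
  map_add' _ _ := rfl
  map_smul' _ _ := rfl

/-- The antipode `S(f)(h) = f(h⁻¹)`. -/
def antipodeLin (k H : Type*) [Field k] [Group H] : FunAlg k H →ₗ[k] FunAlg k H where
  toFun f := mk fun h => f h⁻¹
  map_add' _ _ := rfl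
  map_smul' _ _ := rfl

variable [DecidableEq H]

theorem antipodeLin_delta (h : H) : antipodeLin k H (delta k h) = delta k h⁻¹ := by
  ext x
  change (if x⁻¹ = h then (1 : k) else 0) = if x = h⁻¹ then 1 else 0
  simp [inv_eq_iff_eq_inv]

theorem counitLin_delta (h : H) : counitLin k H (delta k h) = if h = 1 then 1 else 0 := by
  change (if 1 = h then (1 : k) else 0) = _
  simp [eq_comm]

variable [Fintype H]

/-- The comultiplication of `k^H`, dual to the multiplication of `k[H]`:
`Δ(f) = ∑_{l,m} f(lm) δ_l ⊗ δ_m`. -/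
def comulLin (k H : Type*) [Field k] [Group H] [Fintype H] [DecidableEq H] :
    FunAlg k H →ₗ[k] FunAlg k H ⊗[k] FunAlg k H where
  toFun f := ∑ l : H, ∑ m : H, f (l * m) • (delta k l ⊗ₜ[k] delta k m)
  map_add' f g := by simp [add_smul, Finset.sum_add_distrib]
  map_smul' c f := by simp [mul_smul, Finset.smul_sum]

theorem comulLin_delta (h : H) :
    comulLin k H (delta k h) = ∑ l : H, delta k l ⊗ₜ[k] delta k (l⁻¹ * h) := by
  simp only [comulLin, LinearMap.coe_mk, AddHom.coe_mk, delta_apply]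
  refine Finset.sum_congr rfl fun l _ => ?_
  rw [Finset.sum_eq_single (l⁻¹ * h)]
  · simp
  · intro m _ hm
    rw [if_neg, zero_smul]
    rintro rfl; simp at hm
  · simp

instance : Coalgebra k (FunAlg k H) where
  comul := comulLin k H
  counit := counitLin k H
  coassoc := by
    refine lin_ext fun h => ?_
    simp only [LinearMap.coe_comp, Function.comp_apply, LinearEquiv.coe_coe, comulLin_delta,
      map_sum, LinearMap.rTensor_tmul, LinearMap.lTensor_tmul, TensorProduct.sum_tmul,
      TensorProduct.tmul_sum, TensorProduct.assoc_tmul]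
    rw [Finset.sum_comm]
    refine Finset.sum_congr rfl fun l _ => ?_
    rw [← Equiv.sum_comp (Equiv.mulLeft l)]
    simp [mul_assoc]
  rTensor_counit_comp_comul := by
    refine lin_ext fun h => ?_
    simp [comulLin_delta, counitLin_delta, TensorProduct.ite_tmul]
  lTensor_counit_comp_comul := by
    refine lin_ext fun h => ?_
    simp [comulLin_delta, counitLin_delta, TensorProduct.tmul_ite, inv_mul_eq_one]

theorem comul_delta (h : H) : CoalgebraStruct.comul (R := k) (delta k h) =
    ∑ l : H, delta k l ⊗ₜ[k] delta k (l⁻¹ * h) := comulLin_delta h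

theorem counit_apply (f : FunAlg k H) : CoalgebraStruct.counit (R := k) f = f 1 := rfl

instance : Bialgebra k (FunAlg k H) where
  counit_one := rfl
  mul_compr₂_counit := by ext; rfl
  comul_one := by
    change comulLin k H 1 = 1
    simp only [comulLin, LinearMap.coe_mk, AddHom.coe_mk, one_apply, one_smul,
      ← TensorProduct.tmul_sum, ← TensorProduct.sum_tmul, sum_delta]
    rfl
  mul_compr₂_comul := by
    refine lin_ext fun h => lin_ext fun m => ?_
    change comulLin k H (delta k h * delta k m) =
      comulLin k H (delta k h) * comulLin k H (delta k m)
    simp only [comulLin_delta, Finset.sum_mul_sum, Algebra.TensorProduct.tmul_mul_tmul, delta_mul,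
      TensorProduct.ite_tmul]
    simp only [Finset.sum_ite_eq, Finset.mem_univ, if_true, mul_right_inj]
    by_cases hm : h = m
    · subst hm; simp [comulLin_delta]
    · simp [hm]

instance : HopfAlgebra k (FunAlg k H) where
  antipode := antipodeLin k H
  mul_antipode_rTensor_comul := by
    refine lin_ext fun h => ?_
    simp only [LinearMap.coe_comp, Function.comp_apply, comul_delta, map_sum,
      LinearMap.rTensor_tmul, LinearMap.mul'_apply, antipodeLin_delta, delta_mul, counit_apply,
      left_eq_mul, Algebra.linearMap_apply, delta_apply]
    by_cases hh : h = 1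
    · subst hh
      simp only [if_true, map_one, ← sum_delta]
      exact Equiv.sum_comp (Equiv.inv H) (delta k)
    · simp [hh, Ne.symm hh]
  mul_antipode_lTensor_comul := by
    refine lin_ext fun h => ?_
    simp only [LinearMap.coe_comp, Function.comp_apply, comul_delta, map_sum,
      LinearMap.lTensor_tmul, LinearMap.mul'_apply, antipodeLin_delta, delta_mul, counit_apply,
      mul_inv_rev, inv_inv, right_eq_mul, inv_eq_one, Algebra.linearMap_apply, delta_apply]
    by_cases hh : h = 1
    · subst hh
      simp [sum_delta]
    · simp [hh, Ne.symm hh]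

end Hopf

end FunAlg
/-- Data for a Hopf algebra on the vector space with basis `x # δ_h` (`x ∈ Q`, `h ∈ H`): an action
of `H` on `Q` by automorphisms, and scalar functions `σ` (product), `τ` (coproduct) and `ω`
(antipode), subject to the compatibilities that make the structure maps below a Hopf algebra.
This is only a common device for constructing the smash coproduct (where `σ = τ = ω = 1`) and
the Hopf algebra of a quotient datum. -/
structure CrossedDatum (k Q H : Type*) [Field k] [Group Q] [Group H] where
  act : H →* MulAut Q
  σ : Q → Q → H → k
  τ : H → Q → H → k
  ω : Q → H → k
  σ_assoc : ∀ x y z h, σ x y h * σ (x * y) z h = σ y z h * σ x (y * z) h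
  σ_one_left : ∀ x h, σ 1 x h = 1
  σ_one_right : ∀ x h, σ x 1 h = 1
  σ_counit : ∀ x y, σ x y 1 = 1
  τ_one : ∀ x h, τ 1 x h = 1
  τ_counit : ∀ l x, τ l x 1 = 1
  τ_unit : ∀ l h, τ l 1 h = 1
  τ_coassoc : ∀ m n x h,
    τ m x n⁻¹ * τ (n * m) x (n * m * h) = τ n (act m x) (n * m * h) * τ m x (m * h)
  σ_τ : ∀ l x y h, σ x y h * τ l (x * y) (l * h) =
    σ x y l⁻¹ * σ (act l x) (act l y) (l * h) * (τ l x (l * h) * τ l y (l * h))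
  ω_left : ∀ l x, ω x l⁻¹ * σ (act l x⁻¹) (act l x) l * τ l x l = 1
  ω_right : ∀ l x, σ x x⁻¹ l⁻¹ * ω (act l x) l * τ l x l = 1

namespace CrossedDatum

variable {k Q H : Type*} [Field k] [Group Q] [Group H]

/-- The vector space with basis `x # δ_h`, for `x ∈ Q` and `h ∈ H`. -/
def Alg (_D : CrossedDatum k Q H) : Type _ := Q × H →₀ k

variable (D : CrossedDatum k Q H)

instance : AddCommGroup D.Alg := inferInstanceAs (AddCommGroup (Q × H →₀ k))
instance : Module k D.Alg := inferInstanceAs (Module k (Q × H →₀ k))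

/-- The basis element `x # δ_h`. -/
def basis (x : Q) (h : H) : D.Alg := Finsupp.single (x, h) (1 : k)

/-- The linear map with prescribed values on the basis. -/
def lift {M : Type*} [AddCommGroup M] [Module k M] (v : Q → H → M) : D.Alg →ₗ[k] M :=
  Finsupp.linearCombination k (fun p : Q × H => v p.1 p.2)

@[simp] theorem lift_basis {M : Type*} [AddCommGroup M] [Module k M] (v : Q → H → M)
    (x : Q) (h : H) : D.lift v (D.basis x h) = v x h := by
  change Finsupp.linearCombination k (fun p : Q × H => v p.1 p.2) (Finsupp.single (x, h) 1) = _
  simp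

variable {D} in
theorem lin_ext {M : Type*} [AddCommMonoid M] [Module k M] {φ ψ : D.Alg →ₗ[k] M}
    (h : ∀ x l, φ (D.basis x l) = ψ (D.basis x l)) : φ = ψ :=
  Finsupp.lhom_ext' (M := k) (φ := φ) (ψ := ψ) fun p => LinearMap.ext_ring (h p.1 p.2)

section Unit

variable [Fintype H]

/-- The element `x # f`, for `x ∈ Q` and `f ∈ k^H`. -/
def tmul (x : Q) (f : FunAlg k H) : D.Alg := ∑ h : H, f h • D.basis x h

instance : One D.Alg := ⟨D.tmul 1 1⟩

theorem one_def : (1 : D.Alg) = ∑ h : H, D.basis 1 h := by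
  change D.tmul 1 1 = _
  simp [tmul]

end Unit

variable [DecidableEq H]

/-- The product: `(x # δ_h)(y # δ_l) = xy # σ(x,y) δ_h δ_l`. -/
def mulLin : D.Alg →ₗ[k] D.Alg →ₗ[k] D.Alg :=
  D.lift fun x h => D.lift fun y l => if h = l then D.σ x y h • D.basis (x * y) h else 0

instance : Mul D.Alg := ⟨fun a b => D.mulLin a b⟩

theorem mul_def (a b : D.Alg) : a * b = D.mulLin a b := rfl

theorem basis_mul (x y : Q) (h l : H) : D.basis x h * D.basis y l =
    if h = l then D.σ x y h • D.basis (x * y) h else 0 := by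
  simp [mul_def, mulLin]

theorem mul_assoc_aux (a b c : D.Alg) : a * b * c = a * (b * c) := by
  suffices h : D.mulLin.compr₂ D.mulLin =
      (LinearMap.llcomp k D.Alg D.Alg D.Alg ∘ₗ D.mulLin).compl₂ D.mulLin from
    LinearMap.congr_fun (LinearMap.congr_fun (LinearMap.congr_fun h a) b) c
  refine lin_ext fun x h => lin_ext fun y l => lin_ext fun z m => ?_
  change D.basis x h * D.basis y l * D.basis z m = D.basis x h * (D.basis y l * D.basis z m)
  have h0 : ∀ a : D.Alg, 0 * a = 0 := fun a => by simp [mul_def]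
  have h0' : ∀ a : D.Alg, a * 0 = 0 := fun a => by simp [mul_def]
  have h1 : ∀ (c : k) (a b : D.Alg), (c • a) * b = c • (a * b) := fun c a b => by simp [mul_def]
  have h2 : ∀ (c : k) (a b : D.Alg), a * (c • b) = c • (a * b) := fun c a b => by simp [mul_def]
  by_cases hl : h = l
  · subst hl
    by_cases hm : h = m
    · subst hm
      simp [basis_mul, h1, h2, smul_smul, D.σ_assoc, mul_assoc]
    · simp [basis_mul, h1, h0', hm]
  · by_cases hm : l = m
    · subst hm
      simp [basis_mul, h0, h2, hl]
    · simp [basis_mul, h0, h0', hl, hm]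

variable [Fintype H]

theorem one_mul_aux (a : D.Alg) : 1 * a = a := by
  suffices h : D.mulLin 1 = LinearMap.id from LinearMap.congr_fun h a
  refine lin_ext fun x h => ?_
  rw [one_def, map_sum, LinearMap.sum_apply]
  simp only [← mul_def, basis_mul, D.σ_one_left]
  simp

theorem mul_one_aux (a : D.Alg) : a * 1 = a := by
  suffices h : D.mulLin.flip 1 = LinearMap.id from LinearMap.congr_fun h a
  refine lin_ext fun x h => ?_
  rw [LinearMap.flip_apply, one_def, map_sum]
  simp only [← mul_def, basis_mul, D.σ_one_right]
  simp

instance : Ring D.Alg where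
  __ := (inferInstance : AddCommGroup D.Alg)
  mul_assoc := D.mul_assoc_aux
  one_mul := D.one_mul_aux
  mul_one := D.mul_one_aux
  zero_mul a := by simp [mul_def]
  mul_zero a := by simp [mul_def]
  left_distrib a b c := by simp [mul_def]
  right_distrib a b c := by simp [mul_def]

instance : Algebra k D.Alg :=
  Algebra.ofModule (fun c a b => by simp [mul_def]) (fun c a b => by simp [mul_def])

/-- The counit: `ε(x # δ_h) = δ_{h,1}`. -/
def counitLin : D.Alg →ₗ[k] k := D.lift fun _ h => if h = 1 then 1 else 0

/-- The coproduct: `Δ(x # δ_h) = ∑_l (x # δ_{l⁻¹}) ⊗ (l.x # τ_l(x) δ_{lh})`. -/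
def comulLin : D.Alg →ₗ[k] D.Alg ⊗[k] D.Alg :=
  D.lift fun x h => ∑ l : H,
    D.basis x l⁻¹ ⊗ₜ[k] (D.τ l x (l * h) • D.basis (D.act l x) (l * h))

/-- The antipode: `S(x # δ_h) = ω(x)(h) (h⁻¹.x⁻¹ # δ_{h⁻¹})`. -/
def antipodeLin : D.Alg →ₗ[k] D.Alg :=
  D.lift fun x h => D.ω x h • D.basis (D.act h⁻¹ x⁻¹) h⁻¹

instance : Coalgebra k D.Alg where
  comul := D.comulLin
  counit := D.counitLin
  coassoc := by
    refine lin_ext fun x h => ?_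
    simp only [LinearMap.coe_comp, Function.comp_apply, LinearEquiv.coe_coe, comulLin, lift_basis,
      map_sum, LinearMap.rTensor_tmul, LinearMap.lTensor_tmul, TensorProduct.sum_tmul,
      TensorProduct.tmul_sum, TensorProduct.assoc_tmul, map_smul, TensorProduct.tmul_smul,
      TensorProduct.smul_tmul', Finset.smul_sum, smul_smul]
    rw [Finset.sum_comm]
    refine Finset.sum_congr rfl fun m _ => ?_
    rw [← Equiv.sum_comp (Equiv.mulRight m)]
    refine Finset.sum_congr rfl fun n _ => ?_
    have h1 := D.τ_coassoc m n x h
    simp only [Equiv.coe_mulRight, mul_inv_rev, mul_inv_cancel_left, map_mul, MulAut.mul_apply]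
    rw [mul_comm, h1, mul_comm, mul_assoc, ← TensorProduct.smul_tmul', ← TensorProduct.smul_tmul',
      ← TensorProduct.smul_tmul', TensorProduct.tmul_smul, smul_smul]
  rTensor_counit_comp_comul := by
    refine lin_ext fun x h => ?_
    simp [comulLin, counitLin, TensorProduct.ite_tmul, D.τ_one]
  lTensor_counit_comp_comul := by
    refine lin_ext fun x h => ?_
    simp only [comulLin, counitLin, LinearMap.coe_comp, Function.comp_apply, lift_basis, map_sum,
      LinearMap.lTensor_tmul, map_smul]
    rw [Finset.sum_eq_single h⁻¹]
    · simp [D.τ_counit]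
    · intro l _ hl
      rw [if_neg, smul_zero, TensorProduct.tmul_zero]
      rwa [mul_eq_one_iff_eq_inv]
    · simp

theorem comul_basis (x : Q) (h : H) : CoalgebraStruct.comul (R := k) (D.basis x h) =
    ∑ l : H, D.basis x l⁻¹ ⊗ₜ[k] (D.τ l x (l * h) • D.basis (D.act l x) (l * h)) :=
  D.lift_basis _ _ _

theorem counit_basis (x : Q) (h : H) : CoalgebraStruct.counit (R := k) (D.basis x h) =
    if h = 1 then 1 else 0 :=
  D.lift_basis _ _ _

instance : Bialgebra k D.Alg where
  counit_one := by simp [one_def, counit_basis]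
  mul_compr₂_counit := by
    refine lin_ext fun x h => lin_ext fun y l => ?_
    simp only [LinearMap.compr₂_apply, LinearMap.mul_apply', LinearMap.compl₁₂_apply, counit_basis,
      basis_mul]
    by_cases hl : h = l
    · subst hl
      by_cases h1 : h = 1
      · subst h1; simp [counit_basis, D.σ_counit]
      · simp [counit_basis, h1]
    · simp only [hl, if_false, map_zero]
      split_ifs <;> simp_all
  comul_one := by
    rw [one_def, map_sum]
    simp only [comul_basis, D.τ_unit, map_one, one_smul]
    rw [Finset.sum_comm]
    simp only [← TensorProduct.tmul_sum]
    have : ∀ l : H, ∑ h : H, D.basis 1 (l * h) = 1 := fun l => by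
      rw [one_def]; exact Equiv.sum_comp (Equiv.mulLeft l) (D.basis 1)
    simp only [this, ← TensorProduct.sum_tmul]
    have hinv : ∑ l : H, D.basis 1 l⁻¹ = 1 := by
      rw [one_def]; exact Equiv.sum_comp (Equiv.inv H) (D.basis 1)
    rw [hinv]
    rfl
  mul_compr₂_comul := by
    refine lin_ext fun x h => lin_ext fun y m => ?_
    simp only [LinearMap.compr₂_apply, LinearMap.mul_apply', LinearMap.compl₁₂_apply, comul_basis,
      basis_mul, Finset.sum_mul_sum, Algebra.TensorProduct.tmul_mul_tmul, inv_inj,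
      TensorProduct.ite_tmul, Finset.sum_ite_eq, Finset.mem_univ, if_true, smul_mul_smul_comm,
      mul_right_inj]
    by_cases hm : h = m
    · subst hm
      simp only [if_true, map_smul, comul_basis, Finset.smul_sum, TensorProduct.tmul_smul,
        TensorProduct.smul_tmul', smul_smul, map_mul]
      refine Finset.sum_congr rfl fun l _ => ?_
      rw [D.σ_τ]
      congr 2
      ring
    · simp [hm]

instance : HopfAlgebra k D.Alg where
  antipode := D.antipodeLin
  mul_antipode_rTensor_comul := by
    refine lin_ext fun x h => ?_
    simp only [LinearMap.coe_comp, Function.comp_apply, comul_basis, map_sum,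
      LinearMap.rTensor_tmul, LinearMap.mul'_apply, antipodeLin, lift_basis, counit_basis,
      smul_mul_smul_comm, basis_mul, inv_inv, left_eq_mul, Algebra.linearMap_apply]
    by_cases hh : h = 1
    · subst hh
      simp only [if_true, map_one, one_def, mul_one, smul_smul, ← map_mul, inv_mul_cancel]
      refine Finset.sum_congr rfl fun l _ => ?_
      rw [mul_right_comm, D.ω_left, one_smul]
    · simp [hh]
  mul_antipode_lTensor_comul := by
    refine lin_ext fun x h => ?_
    simp only [LinearMap.coe_comp, Function.comp_apply, comul_basis, map_sum,
      LinearMap.lTensor_tmul, LinearMap.mul'_apply, antipodeLin, lift_basis, counit_basis, map_smul,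
      mul_smul_comm, basis_mul, mul_inv_rev, right_eq_mul, inv_eq_one, Algebra.linearMap_apply]
    by_cases hh : h = 1
    · subst hh
      simp only [if_true, map_one, one_def, mul_one, smul_smul, inv_one, one_mul, map_inv,
        MulAut.inv_apply_self, mul_inv_cancel]
      rw [← Equiv.sum_comp (Equiv.inv H)]
      refine Finset.sum_congr rfl fun l _ => ?_
      have hω := D.ω_right l⁻¹ x
      simp at hω ⊢
      rw [show D.τ l⁻¹ x l⁻¹ * (D.ω ((MulEquiv.symm (D.act l)) x) l⁻¹ * D.σ x x⁻¹ l) = 1 by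
        rw [← hω]; ring, one_smul]
    · simp [hh]

theorem antipode_basis (x : Q) (h : H) : HopfAlgebraStruct.antipode k (D.basis x h) =
    D.ω x h • D.basis (D.act h⁻¹ x⁻¹) h⁻¹ := by
  change D.antipodeLin _ = _
  rw [antipodeLin, lift_basis]

/-- The linear map `f ↦ 1 # f`. -/
def inclLin : FunAlg k H →ₗ[k] D.Alg where
  toFun f := D.tmul 1 f
  map_add' f g := by simp [tmul, add_smul, Finset.sum_add_distrib]
  map_smul' c f := by simp [tmul, mul_smul, Finset.smul_sum]

/-- The algebra embedding `k^H → D.Alg`, `f ↦ 1 # f`. -/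
def incl : FunAlg k H →ₐ[k] D.Alg :=
  AlgHom.ofLinearMap D.inclLin rfl fun f g => by
    change D.tmul 1 (f * g) = D.tmul 1 f * D.tmul 1 g
    simp [tmul, Finset.sum_mul_sum, basis_mul, smul_smul, mul_comm, D.σ_one_left]

theorem incl_apply (f : FunAlg k H) : D.incl f = D.tmul 1 f := rfl

end CrossedDatum

section Smash

variable (k Γ H : Type*) [Field k] [Group Γ] [Group H] [MulDistribMulAction H Γ]

/-- The crossed datum with trivial `σ`, `τ`, `ω`. -/
def smashDatum : CrossedDatum k Γ H where
  act := MulDistribMulAction.toMulAut H Γ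
  σ _ _ _ := 1
  τ _ _ _ := 1
  ω _ _ := 1
  σ_assoc _ _ _ _ := rfl
  σ_one_left _ _ := rfl
  σ_one_right _ _ := rfl
  σ_counit _ _ := rfl
  τ_one _ _ := rfl
  τ_counit _ _ := rfl
  τ_unit _ _ := rfl
  τ_coassoc _ _ _ _ := rfl
  σ_τ _ _ _ _ := by simp
  ω_left _ _ := by simp
  ω_right _ _ := by simp

/-- The smash coproduct Hopf algebra `k[Γ] ⋊ k^H`. Its structure maps are made explicit in the
lemmas below. -/
abbrev SmashCoproduct : Type _ := (smashDatum k Γ H).Alg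

namespace SmashCoproduct

variable {Γ H}

/-- The basis element `r # δ_h` of `k[Γ] ⋊ k^H`. -/
abbrev basis (r : Γ) (h : H) : SmashCoproduct k Γ H := (smashDatum k Γ H).basis r h

theorem one_eq [Fintype H] :
    (1 : SmashCoproduct k Γ H) = (smashDatum k Γ H).tmul 1 1 := rfl

variable [DecidableEq H]

theorem basis_mul_basis (r s : Γ) (h l : H) :
    basis k r h * basis k s l = if h = l then basis k (r * s) h else 0 := by
  rw [CrossedDatum.basis_mul]
  split_ifs
  · exact one_smul k _
  · rfl

variable [Fintype H]

variable {k} in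
/-- The element `r # f` of `k[Γ] ⋊ k^H`, for `r ∈ Γ` and `f ∈ k^H`. -/
abbrev tmul (r : Γ) (f : FunAlg k H) : SmashCoproduct k Γ H := (smashDatum k Γ H).tmul r f

variable (Γ H) in
/-- The embedding `k^H → k[Γ] ⋊ k^H`, `f ↦ 1 # f`. -/
abbrev incl : FunAlg k H →ₐ[k] SmashCoproduct k Γ H := (smashDatum k Γ H).incl

theorem comul_basis (r : Γ) (h : H) : CoalgebraStruct.comul (R := k) (basis k r h) =
    ∑ l : H, basis k r l⁻¹ ⊗ₜ[k] basis k (l • r) (l * h) := by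
  rw [CrossedDatum.comul_basis]
  exact Finset.sum_congr rfl fun l _ => congrArg _ (one_smul k _)

theorem counit_basis (r : Γ) (h : H) : CoalgebraStruct.counit (R := k) (basis k r h) =
    if h = 1 then 1 else 0 := CrossedDatum.counit_basis _ _ _

theorem antipode_basis (r : Γ) (h : H) : HopfAlgebraStruct.antipode k (basis k r h) =
    basis k (h⁻¹ • r⁻¹) h⁻¹ := by
  rw [CrossedDatum.antipode_basis]
  exact one_smul k _

end SmashCoproduct

end Smash

/-- A quotient datum `(N, Φ)` (with full subgroup `H`) for `H` acting on `Γ`: a normal `H`-stable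
subgroup `N` of `Γ` and a group morphism `Φ : N → (k^H)ˣ` with
`Φ(r)(lh) = Φ(l⁻¹.r)(h) Φ(r)(l)` and `Φ(s r s⁻¹) = Φ(r)`. -/
structure QuotientDatum (k Γ H : Type*) [Field k] [Group Γ] [Group H]
    [MulDistribMulAction H Γ] where
  N : Subgroup Γ
  normal : N.Normal
  stable : ∀ (h : H) (r : Γ), r ∈ N → h • r ∈ N
  Φ : N →* (FunAlg k H)ˣ
  Φ_mul : ∀ (r : N) (l h : H), (Φ r : FunAlg k H) (l * h) =
    (Φ ⟨l⁻¹ • (r : Γ), stable l⁻¹ r r.2⟩ : FunAlg k H) h * (Φ r : FunAlg k H) l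
  Φ_conj : ∀ (r : N) (s : Γ), Φ r = Φ ⟨s * r * s⁻¹, normal.conj_mem r r.2 s⟩

namespace QuotientDatum

variable {k Γ H : Type*} [Field k] [Group Γ] [Group H] [MulDistribMulAction H Γ]

instance (D : QuotientDatum k Γ H) : D.N.Normal := D.normal

/-- The order by extension: `(N, Φ) ≤ (M, Ψ)` iff `N ⊆ M` and `Ψ` restricts to `Φ` on `N`. -/
instance : PartialOrder (QuotientDatum k Γ H) where
  le D E := ∃ hN : D.N ≤ E.N, ∀ r : D.N, E.Φ ⟨r, hN r.2⟩ = D.Φ r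
  le_refl D := ⟨le_refl _, fun _ => rfl⟩
  le_trans D E F := fun ⟨h1, h2⟩ ⟨h3, h4⟩ =>
    ⟨h1.trans h3, fun r => (h4 ⟨r, h1 r.2⟩).trans (h2 r)⟩
  le_antisymm D E := by
    rintro ⟨h1, h2⟩ ⟨h3, -⟩
    obtain ⟨N, a, b, Φ, c, d⟩ := D
    obtain ⟨M, a', b', Ψ, c', d'⟩ := E
    obtain rfl : N = M := le_antisymm h1 h3
    obtain rfl : Φ = Ψ := MonoidHom.ext fun r => (h2 r).symm
    rfl

variable (D : QuotientDatum k Γ H)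

/-- `Φ(r) ∈ k^H`, for an element `r` of `Γ` that lies in `N`. -/
def phi (r : Γ) (hr : r ∈ D.N) : FunAlg k H := (D.Φ ⟨r, hr⟩ : FunAlg k H)

/-- The endomorphism of `Γ/N` induced by an element of `H`. -/
def quotMap (h : H) : Γ ⧸ D.N →* Γ ⧸ D.N :=
  QuotientGroup.map D.N D.N (MulDistribMulAction.toMonoidHom Γ h) (D.stable h)

theorem quotMap_mk (h : H) (r : Γ) : D.quotMap h (r : Γ ⧸ D.N) = ((h • r : Γ) : Γ ⧸ D.N) := rfl

/-- The induced action of `H` on `Γ/N`, given by `h.u(r) = u(h.r)`. -/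
def quotAct : H →* MulAut (Γ ⧸ D.N) where
  toFun h :=
    { toFun := D.quotMap h
      invFun := D.quotMap h⁻¹
      left_inv := by rintro ⟨r⟩; exact congrArg _ (inv_smul_smul h r)
      right_inv := by rintro ⟨r⟩; exact congrArg _ (smul_inv_smul h r)
      map_mul' := map_mul _ }
  map_one' := by ext ⟨r⟩; exact congrArg _ (one_smul H r)
  map_mul' h l := by ext ⟨r⟩; exact congrArg _ (mul_smul h l r)

@[simp] theorem quotAct_mk (h : H) (r : Γ) :
    D.quotAct h (r : Γ ⧸ D.N) = ((h • r : Γ) : Γ ⧸ D.N) := rfl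

/-- A section `j` of the canonical projection `u : Γ → Γ/N`, with `j(u(1)) = 1`. -/
structure Sec where
  toFun : Γ ⧸ D.N → Γ
  mk_toFun : ∀ x : Γ ⧸ D.N, (toFun x : Γ ⧸ D.N) = x
  map_one : toFun 1 = 1

variable {D}

instance : CoeFun D.Sec (fun _ => Γ ⧸ D.N → Γ) := ⟨Sec.toFun⟩

@[simp] theorem Sec.mk_apply (j : D.Sec) (x : Γ ⧸ D.N) : ((j x : Γ) : Γ ⧸ D.N) = x := j.mk_toFun x

theorem Sec.mem (j : D.Sec) (r : Γ) : r * (j (r : Γ ⧸ D.N))⁻¹ ∈ D.N := by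
  rw [← QuotientGroup.eq_one_iff]; simp

theorem Sec.mem_mul (j : D.Sec) (x y : Γ ⧸ D.N) : j x * j y * (j (x * y))⁻¹ ∈ D.N := by
  rw [← QuotientGroup.eq_one_iff]; simp

theorem Sec.mem_act (j : D.Sec) (l : H) (x : Γ ⧸ D.N) :
    (l • j x) * (j (D.quotAct l x))⁻¹ ∈ D.N := by
  rw [← QuotientGroup.eq_one_iff]; simp [← quotAct_mk]

theorem Sec.mem_inv (j : D.Sec) (h : H) (x : Γ ⧸ D.N) :
    (j (D.quotAct h⁻¹ x⁻¹))⁻¹ * h⁻¹ • (j x)⁻¹ ∈ D.N := by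
  rw [← QuotientGroup.eq_one_iff]
  simp only [QuotientGroup.mk_mul, QuotientGroup.mk_inv, ← quotAct_mk, Sec.mk_apply]
  simp

theorem phi_ne_zero (r : Γ) (hr : r ∈ D.N) (h : H) : D.phi r hr h ≠ 0 := by
  intro h0
  have h1 : D.phi r hr * ((D.Φ ⟨r, hr⟩)⁻¹ : (FunAlg k H)ˣ) = 1 := Units.mul_inv _
  have h2 := congrArg (fun f : FunAlg k H => f h) h1
  simp [h0] at h2

theorem phi_congr {r s : Γ} (hrs : r = s) (hr : r ∈ D.N) :
    D.phi r hr = D.phi s (hrs ▸ hr) := by subst hrs; rfl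

theorem phi_one (h1 : (1 : Γ) ∈ D.N) : D.phi 1 h1 = 1 := by
  have : D.Φ ⟨1, h1⟩ = 1 := map_one D.Φ
  simp [phi, this]

theorem phi_mul {r s : Γ} (hr : r ∈ D.N) (hs : s ∈ D.N) :
    D.phi r hr * D.phi s hs = D.phi (r * s) (mul_mem hr hs) := by
  have : D.Φ ⟨r * s, mul_mem hr hs⟩ = D.Φ ⟨r, hr⟩ * D.Φ ⟨s, hs⟩ := map_mul D.Φ ⟨r, hr⟩ ⟨s, hs⟩
  simp [phi, this]

theorem phi_conj (s : Γ) {r : Γ} (hr : r ∈ D.N) :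
    D.phi r hr = D.phi (s * r * s⁻¹) (D.normal.conj_mem r hr s) := by
  simp only [phi, D.Φ_conj ⟨r, hr⟩ s]

theorem phi_twist {r : Γ} (hr : r ∈ D.N) (l h : H) :
    D.phi r hr (l * h) = D.phi (l⁻¹ • r) (D.stable l⁻¹ r hr) h * D.phi r hr l :=
  D.Φ_mul ⟨r, hr⟩ l h

theorem phi_at_one {r : Γ} (hr : r ∈ D.N) : D.phi r hr 1 = 1 := by
  have h := phi_twist hr 1 1
  rw [mul_one] at h
  have h2 := phi_ne_zero r hr (1 : H)
  have h3 : D.phi ((1 : H)⁻¹ • r) (D.stable 1⁻¹ r hr) = D.phi r hr := phi_congr (by simp) _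
  rw [h3] at h
  exact (mul_eq_left₀ h2).1 h.symm

/-- The function `g(r) = Φ(r j(u(r))⁻¹)`. -/
def gauge (j : D.Sec) (r : Γ) : FunAlg k H := D.phi (r * (j (r : Γ ⧸ D.N))⁻¹) (j.mem r)

theorem gauge_ne_zero (j : D.Sec) (r : Γ) (h : H) : gauge j r h ≠ 0 := phi_ne_zero _ _ _

theorem gauge_at_one (j : D.Sec) (r : Γ) : gauge j r 1 = 1 := phi_at_one _

theorem gauge_one (j : D.Sec) (h : H) : gauge j 1 h = 1 := by
  have h1 : (1 : Γ) * (j ((1 : Γ) : Γ ⧸ D.N))⁻¹ = 1 := by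
    rw [QuotientGroup.mk_one, j.map_one]; simp
  rw [gauge, phi_congr h1, phi_one, FunAlg.one_apply]

theorem gauge_σ (j : D.Sec) (r s : Γ) (h : H) :
    gauge j r h * gauge j s h * D.phi _ (j.mem_mul (r : Γ ⧸ D.N) (s : Γ ⧸ D.N)) h =
      gauge j (r * s) h := by
  have h1 : gauge j r * gauge j s * D.phi _ (j.mem_mul (r : Γ ⧸ D.N) (s : Γ ⧸ D.N)) =
      gauge j (r * s) := by
    rw [gauge, gauge, phi_conj (j (r : Γ ⧸ D.N)) (j.mem s), phi_mul, phi_mul, gauge]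
    refine phi_congr ?_ _
    simp only [QuotientGroup.mk_mul]
    group
  rw [← h1]; rfl

theorem gauge_τ (j : D.Sec) (l : H) (r : Γ) (h : H) :
    gauge j r l⁻¹ * gauge j (l • r) (l * h) =
      gauge j r h * D.phi _ (j.mem_act l (r : Γ ⧸ D.N)) (l * h) := by
  have h1 : gauge j (l • r) = D.phi _ (D.stable l _ (j.mem r)) *
      D.phi _ (j.mem_act l (r : Γ ⧸ D.N)) := by
    rw [phi_mul, gauge]
    refine phi_congr ?_ _
    simp only [smul_mul', smul_inv', quotAct_mk]
    group
  have h2 := phi_twist (j.mem r) l⁻¹ (l * h)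
  simp only [inv_mul_cancel_left, inv_inv] at h2
  rw [h1, FunAlg.mul_apply]
  change _ = D.phi _ (j.mem r) h * _
  rw [h2]
  change D.phi _ (j.mem r) l⁻¹ * _ = _
  ring

theorem gauge_ω (j : D.Sec) (r : Γ) (h : H) :
    gauge j (h⁻¹ • r⁻¹) h⁻¹ = gauge j r h * D.phi _ (j.mem_inv h (r : Γ ⧸ D.N)) h⁻¹ := by
  have hc := inv_mem (j.mem r)
  have hc' : r⁻¹ * j (r : Γ ⧸ D.N) ∈ D.N := by
    rw [← QuotientGroup.eq_one_iff]; simp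
  have h0 : D.phi _ hc' = D.phi _ hc := by
    rw [phi_conj r hc']
    exact phi_congr (by group) _
  have h1 : gauge j (h⁻¹ • r⁻¹) = D.phi _ (D.stable h⁻¹ _ hc) *
      D.phi _ (j.mem_inv h (r : Γ ⧸ D.N)) := by
    rw [phi_conj (j (D.quotAct h⁻¹ (r : Γ ⧸ D.N)⁻¹)) (j.mem_inv h (r : Γ ⧸ D.N)),
      phi_conj (h⁻¹ • (r⁻¹ : Γ)) (D.stable h⁻¹ _ hc), phi_mul, gauge]
    refine phi_congr ?_ _
    have he : ((h⁻¹ • r⁻¹ : Γ) : Γ ⧸ D.N) = D.quotAct h⁻¹ (r : Γ ⧸ D.N)⁻¹ := rfl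
    rw [he]
    simp only [mul_inv_rev, inv_inv, smul_mul', smul_inv']
    group
  have h2 := phi_twist hc h h⁻¹
  rw [mul_inv_cancel, phi_at_one] at h2
  have h3 : gauge j r h * D.phi _ hc h = 1 := by
    have h4 : gauge j r * D.phi _ hc = 1 := by
      rw [gauge, phi_mul]
      exact (phi_congr (mul_inv_cancel _) _).trans (phi_one (one_mem _))
    rw [← FunAlg.mul_apply, h4]; rfl
  have h5 : D.phi _ (D.stable h⁻¹ _ hc) h⁻¹ = gauge j r h := by
    rw [← mul_right_inj' (phi_ne_zero _ hc h), mul_comm, ← h2, mul_comm, h3]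
  rw [h1, FunAlg.mul_apply, h5]

/-- `σ(x,y) = Φ(j(x) j(y) j(xy)⁻¹)` -/
def sig (j : D.Sec) (x y : Γ ⧸ D.N) : FunAlg k H :=
  D.phi (j x * j y * (j (x * y))⁻¹) (j.mem_mul x y)

/-- `τ_l(x) = Φ(l.j(x) j(l.x)⁻¹)` -/
def tau (j : D.Sec) (l : H) (x : Γ ⧸ D.N) : FunAlg k H :=
  D.phi ((l • j x) * (j (D.quotAct l x))⁻¹) (j.mem_act l x)

/-- `ω(x)(h) = Φ(j(h⁻¹.x⁻¹)⁻¹ h⁻¹.j(x)⁻¹)(h⁻¹)` -/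
def om (j : D.Sec) (x : Γ ⧸ D.N) (h : H) : k :=
  D.phi ((j (D.quotAct h⁻¹ x⁻¹))⁻¹ * h⁻¹ • (j x)⁻¹) (j.mem_inv h x) h⁻¹

theorem sig_mk (j : D.Sec) (r s : Γ) (h : H) : sig j (r : Γ ⧸ D.N) (s : Γ ⧸ D.N) h =
    gauge j (r * s) h / (gauge j r h * gauge j s h) := by
  rw [eq_div_iff (mul_ne_zero (gauge_ne_zero _ _ _) (gauge_ne_zero _ _ _)), mul_comm]
  exact gauge_σ j r s h

theorem tau_mk (j : D.Sec) (l : H) (r : Γ) (h : H) : tau j l (r : Γ ⧸ D.N) h =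
    gauge j r l⁻¹ * gauge j (l • r) h / gauge j r (l⁻¹ * h) := by
  rw [eq_div_iff (gauge_ne_zero _ _ _), mul_comm]
  have h1 := gauge_τ j l r (l⁻¹ * h)
  rw [mul_inv_cancel_left] at h1
  exact h1.symm

theorem om_mk (j : D.Sec) (r : Γ) (h : H) : om j (r : Γ ⧸ D.N) h =
    gauge j (h⁻¹ • r⁻¹) h⁻¹ / gauge j r h := by
  rw [eq_div_iff (gauge_ne_zero _ _ _), mul_comm]
  exact (gauge_ω j r h).symm

/-- The crossed datum of a quotient datum and a section. -/
def crossed (D : QuotientDatum k Γ H) (j : D.Sec) : CrossedDatum k (Γ ⧸ D.N) H where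
  act := D.quotAct
  σ x y := sig j x y
  τ l x := tau j l x
  ω x := om j x
  σ_assoc x y z h := by
    induction x using QuotientGroup.induction_on with | H r => ?_
    induction y using QuotientGroup.induction_on with | H s => ?_
    induction z using QuotientGroup.induction_on with | H t => ?_
    rw [← QuotientGroup.mk_mul, ← QuotientGroup.mk_mul]
    simp only [sig_mk, mul_assoc]
    have := gauge_ne_zero j (r * s) h
    have := gauge_ne_zero j (s * t) h
    field_simp
  σ_one_left x h := by
    induction x using QuotientGroup.induction_on with | H r => ?_
    rw [← QuotientGroup.mk_one, sig_mk, gauge_one, one_mul, one_mul, div_self (gauge_ne_zero _ _ _)]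
  σ_one_right x h := by
    induction x using QuotientGroup.induction_on with | H r => ?_
    rw [← QuotientGroup.mk_one, sig_mk, gauge_one, mul_one, mul_one, div_self (gauge_ne_zero _ _ _)]
  σ_counit x y := phi_at_one _
  τ_one x h := by
    induction x using QuotientGroup.induction_on with | H r => ?_
    rw [tau_mk, inv_one, one_smul, gauge_at_one, one_mul, one_mul, div_self (gauge_ne_zero _ _ _)]
  τ_counit l x := phi_at_one _
  τ_unit l h := by
    rw [← QuotientGroup.mk_one, tau_mk, smul_one]
    simp only [gauge_one]
    norm_num
  τ_coassoc m n x h := by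
    induction x using QuotientGroup.induction_on with | H r => ?_
    rw [quotAct_mk]
    simp only [tau_mk, mul_inv_rev, inv_mul_cancel_left, mul_smul, mul_assoc]
    have := gauge_ne_zero j r (m⁻¹ * n⁻¹)
    have := gauge_ne_zero j r h
    have := gauge_ne_zero j (m • r) (m * h)
    field_simp
  σ_τ l x y h := by
    induction x using QuotientGroup.induction_on with | H r => ?_
    induction y using QuotientGroup.induction_on with | H s => ?_
    rw [← QuotientGroup.mk_mul, quotAct_mk, quotAct_mk]
    simp only [sig_mk, tau_mk, inv_mul_cancel_left, smul_mul']
    have := gauge_ne_zero j r h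
    have := gauge_ne_zero j s h
    have := gauge_ne_zero j r l⁻¹
    have := gauge_ne_zero j s l⁻¹
    have := gauge_ne_zero j (r * s) h
    have := gauge_ne_zero j (l • r) (l * h)
    have := gauge_ne_zero j (l • s) (l * h)
    field_simp
  ω_left l x := by
    induction x using QuotientGroup.induction_on with | H r => ?_
    rw [← QuotientGroup.mk_inv, quotAct_mk, quotAct_mk]
    simp only [sig_mk, tau_mk, om_mk, inv_inv, inv_mul_cancel, ← smul_mul', smul_one, gauge_one,
      gauge_at_one]
    have := gauge_ne_zero j r l⁻¹
    have := gauge_ne_zero j (l • r) l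
    have := gauge_ne_zero j (l • r⁻¹) l
    field_simp
  ω_right l x := by
    induction x using QuotientGroup.induction_on with | H r => ?_
    rw [← QuotientGroup.mk_inv, quotAct_mk]
    simp only [sig_mk, tau_mk, om_mk, inv_mul_cancel, mul_inv_cancel, ← smul_inv', inv_smul_smul,
      gauge_one, gauge_at_one]
    have := gauge_ne_zero j r l⁻¹
    have := gauge_ne_zero j (l • r) l
    have := gauge_ne_zero j r⁻¹ l⁻¹
    field_simp

/-- The Hopf algebra `k[Γ/N] ⋊_Φ k^H` formed with the section `j`. Its structure maps are made
explicit in the lemmas below. -/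
abbrev QuotientHopf (D : QuotientDatum k Γ H) (j : D.Sec) : Type _ := (D.crossed j).Alg

namespace QuotientHopf

/-- The basis element `x # δ_h` of `k[Γ/N] ⋊_Φ k^H`. -/
abbrev basis (j : D.Sec) (x : Γ ⧸ D.N) (h : H) : D.QuotientHopf j := (D.crossed j).basis x h

variable [Fintype H]

/-- The element `x # f` of `k[Γ/N] ⋊_Φ k^H`. -/
abbrev tmul (j : D.Sec) (x : Γ ⧸ D.N) (f : FunAlg k H) : D.QuotientHopf j :=
  (D.crossed j).tmul x f

theorem one_eq (j : D.Sec) : (1 : D.QuotientHopf j) = tmul j 1 1 := rfl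

variable [DecidableEq H]

theorem tmul_delta (j : D.Sec) (x : Γ ⧸ D.N) (h : H) (f : FunAlg k H) :
    tmul j x (FunAlg.delta k h * f) = f h • basis j x h := by
  simp [tmul, CrossedDatum.tmul]

theorem basis_mul_basis (j : D.Sec) (x y : Γ ⧸ D.N) (h l : H) :
    basis j x h * basis j y l = tmul j (x * y)
      (FunAlg.delta k h * FunAlg.delta k l * D.phi (j x * j y * (j (x * y))⁻¹) (j.mem_mul x y)) := by
  rw [CrossedDatum.basis_mul, FunAlg.delta_mul]
  split_ifs
  · rw [tmul_delta]; rfl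
  · simp [tmul, CrossedDatum.tmul]

theorem comul_basis (j : D.Sec) (x : Γ ⧸ D.N) (h : H) :
    CoalgebraStruct.comul (R := k) (basis j x h) = ∑ l : H, basis j x l⁻¹ ⊗ₜ[k]
      tmul j (D.quotAct l x) (FunAlg.delta k (l * h) *
        D.phi ((l • j x) * (j (D.quotAct l x))⁻¹) (j.mem_act l x)) := by
  simp only [tmul_delta]
  exact CrossedDatum.comul_basis _ _ _

theorem counit_basis (j : D.Sec) (x : Γ ⧸ D.N) (h : H) :
    CoalgebraStruct.counit (R := k) (basis j x h) = if h = 1 then 1 else 0 :=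
  CrossedDatum.counit_basis _ _ _

theorem antipode_basis (j : D.Sec) (x : Γ ⧸ D.N) (h : H) :
    HopfAlgebraStruct.antipode k (basis j x h) = tmul j (D.quotAct h⁻¹ x⁻¹)
      (FunAlg.delta k h⁻¹ *
        D.phi ((j (D.quotAct h⁻¹ x⁻¹))⁻¹ * h⁻¹ • (j x)⁻¹) (j.mem_inv h x)) := by
  rw [tmul_delta]
  exact CrossedDatum.antipode_basis _ _ _

end QuotientHopf

end QuotientDatum

section HopfImage

variable {k A R : Type*} [Field k] [Ring A] [HopfAlgebra k A] [Ring R] [Algebra k R]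

/-- `(L, q, φ)` is a factorization of the algebra map `ρ : A → R`: `q : A → L` is a surjective
map of Hopf algebras, `φ : L → R` is an algebra map, and `ρ = φ ∘ q`. (A bialgebra map between
Hopf algebras automatically commutes with the antipodes.) -/
def IsFactorization (ρ : A →ₐ[k] R) {L : Type*} [Ring L] [HopfAlgebra k L]
    (q : A →ₐc[k] L) (φ : L →ₐ[k] R) : Prop :=
  Function.Surjective q ∧ φ.comp (q : A →ₐ[k] L) = ρ

/-- `(B, p, ψ)` is the Hopf image of `ρ`: it is a final object in the category of factorizations
of `ρ` (tested against Hopf algebras in the universe `w`). -/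
def IsHopfImage (ρ : A →ₐ[k] R) {B : Type*} [Ring B] [HopfAlgebra k B]
    (p : A →ₐc[k] B) (ψ : B →ₐ[k] R) : Prop :=
  IsFactorization ρ p ψ ∧
    ∀ (L : Type w) [Ring L] [HopfAlgebra k L] (q : A →ₐc[k] L) (φ : L →ₐ[k] R),
      IsFactorization ρ q φ →
        ∃! f : L →ₐc[k] B, f.comp q = p ∧ ψ.comp (f : L →ₐ[k] B) = φ

end HopfImage

/-- `ρ` is inner faithful: `(A, id, ρ)` is the Hopf image of `ρ`. Every factorization of `ρ` is
isomorphic to one by a Hopf algebra in the universe of `A`. -/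
def IsInnerFaithful.{a, u, v} {k : Type u} {A : Type a} {R : Type v} [Field k] [Ring A]
    [HopfAlgebra k A] [Ring R] [Algebra k R] (ρ : A →ₐ[k] R) : Prop :=
  IsHopfImage.{a} ρ (BialgHom.id k A) ρ

/-- The set `E(ρ)` of the quotient data `(N, Φ)` with `ρ(r # 1) = ρ(1 # Φ(r))` for all `r ∈ N`. -/
def compatibleData {k Γ H R : Type*} [Field k] [Group Γ] [Group H] [Fintype H] [DecidableEq H]
    [MulDistribMulAction H Γ] [Ring R] [Algebra k R] (ρ : SmashCoproduct k Γ H →ₐ[k] R) :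
    Set (QuotientDatum k Γ H) :=
  {D | ∀ (r : Γ) (hr : r ∈ D.N),
    ρ (SmashCoproduct.tmul r 1) = ρ (SmashCoproduct.tmul 1 (D.phi r hr))}

end

/-
The kernel of a Hopf algebra map `q` through which `ρ` factors is a Hopf ideal contained in `ker ρ`,
so the quotient by the largest such ideal is the Hopf image of `ρ`, and a factorization is universal
as soon as its kernel contains that ideal. When `ρ` is inner faithful on `k^H`, every such `q` is
injective on `k^H`, so it determines a quotient datum: `N` is the set of all `r` such that
`q(r # 1) = q(1 # f)` for some unit `f`, and `Φ(r)` is this unique `f`. If `r` runs over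
representatives of `Γ/N`, the elements `q(r # δ_h)` are simultaneous eigenvectors, with distinct
eigenvalues, of operators built from the coproduct. Hence they are linearly independent, and
`ker q` is contained in the kernel of the projection onto `k[Γ/N] ⋊_Φ k^H`. The datum of the
quotient by the largest Hopf ideal is the greatest element of `E(ρ)`.
-/

noncomputable section

section BialgHom

open WithConv in
theorem bialgHom_antipode {k A B : Type*} [CommSemiring k] [Semiring A] [HopfAlgebra k A]
    [Semiring B] [HopfAlgebra k B] (f : A →ₐc[k] B) (a : A) :
    f (HopfAlgebraStruct.antipode k a) = HopfAlgebraStruct.antipode k (f a) := by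
  have left_inv : toConv (f.toLinearMap ∘ₗ HopfAlgebraStruct.antipode k) * toConv f.toLinearMap =
      (1 : WithConv (A →ₗ[k] B)) := ofConv_injective <| calc
    _ = (AlgHomClass.toAlgHom f).toLinearMap ∘ₗ
          (toConv (HopfAlgebraStruct.antipode k) * toConv .id : WithConv (A →ₗ[k] A)).ofConv := by
        rw [LinearMap.algHom_comp_convMul_distrib]; rfl
    _ = _ := by rw [LinearMap.antipode_mul_id, LinearMap.algHom_comp_convOne]
  have right_inv : toConv f.toLinearMap * toConv (HopfAlgebraStruct.antipode k ∘ₗ f.toLinearMap) =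
      (1 : WithConv (A →ₗ[k] B)) := ofConv_injective <| calc
    _ = (toConv .id * toConv (HopfAlgebraStruct.antipode k) :
          WithConv (B →ₗ[k] B)).ofConv ∘ₗ f.toCoalgHom.toLinearMap := by
        rw [LinearMap.convMul_comp_coalgHom_distrib]; rfl
    _ = _ := by
        rw [LinearMap.id_mul_antipode]
        exact LinearMap.convOne_comp_coalgHom f.toCoalgHom
  exact LinearMap.congr_fun (congrArg WithConv.ofConv (left_inv_eq_right_inv left_inv right_inv)) a

variable {k A B C : Type*}

theorem isCoideal_ker [Field k] [AddCommGroup A] [Module k A] [Coalgebra k A] [AddCommGroup B]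
    [Module k B] [Coalgebra k B] (f : A →ₗc[k] B) : (LinearMap.ker f.toLinearMap).IsCoideal where
  counit_eq_zero x hx := by
    have hx : f x = 0 := hx
    rw [← CoalgHomClass.counit_comp_apply f, hx, map_zero]
  map_mkQ_comul_eq_zero x hx := by
    have hx : f x = 0 := hx
    let g : A ⧸ LinearMap.ker f.toLinearMap →ₗ[k] B := Submodule.liftQ _ f.toLinearMap le_rfl
    have hg : Function.Injective g := LinearMap.ker_eq_bot.1 (Submodule.ker_liftQ_eq_bot' _ _ rfl)
    apply TensorProduct.map_injective_of_flat_flat _ _ hg hg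
    rw [map_zero, ← LinearMap.comp_apply, ← TensorProduct.map_comp, Submodule.liftQ_mkQ]
    exact (CoalgHomClass.map_comp_comul_apply f x).trans (by rw [hx, map_zero])

theorem isHopfIdeal_ker [Field k] [Ring A] [HopfAlgebra k A] [Ring B] [HopfAlgebra k B]
    (f : A →ₐc[k] B) : (RingHom.ker f).IsHopfIdeal k where
  toIsCoideal := isCoideal_ker f.toCoalgHom
  antipode_mem x hx := by
    rw [RingHom.mem_ker] at hx ⊢
    rw [bialgHom_antipode, hx, map_zero]

theorem exists_algHom_comp_eq [CommRing k] [Ring A] [Algebra k A] [Ring B] [Algebra k B] [Ring C]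
    [Algebra k C] {q : A →ₐ[k] B} (hq : Function.Surjective q) {p : A →ₐ[k] C}
    (h : RingHom.ker q ≤ RingHom.ker p) : ∃ g : B →ₐ[k] C, g.comp q = p := by
  let g : B →+* C := RingHom.liftOfSurjective (q : A →+* B) hq ⟨(p : A →+* C), h⟩
  have hg (a : A) : g (q a) = p a :=
    RingHom.liftOfSurjective_comp_apply (q : A →+* B) hq ⟨(p : A →+* C), h⟩ a
  refine ⟨⟨g, fun c => ?_⟩, AlgHom.ext hg⟩
  rw [← q.commutes, ← p.commutes]
  exact hg _

theorem exists_bialgHom_comp_eq [CommRing k] [Ring A] [Bialgebra k A] [Ring B] [Bialgebra k B]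
    [Ring C] [Bialgebra k C] {q : A →ₐc[k] B} (hq : Function.Surjective q) {p : A →ₐc[k] C}
    (h : RingHom.ker q ≤ RingHom.ker p) : ∃ f : B →ₐc[k] C, f.comp q = p := by
  let q' : A →ₐ[k] B := q
  let p' : A →ₐ[k] C := p
  obtain ⟨g, hg⟩ : ∃ g : B →ₐ[k] C, g.comp q' = p' := exists_algHom_comp_eq hq h
  have counit_g : (Bialgebra.counitAlgHom k C).comp g = Bialgebra.counitAlgHom k B := by
    rw [← AlgHom.cancel_right (f := q') hq, AlgHom.comp_assoc, hg]
    exact (BialgHomClass.counitAlgHom_comp p).trans (BialgHomClass.counitAlgHom_comp q).symm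
  have comul_g : (Algebra.TensorProduct.map g g).comp (Bialgebra.comulAlgHom k B) =
      (Bialgebra.comulAlgHom k C).comp g := by
    rw [← AlgHom.cancel_right (f := q') hq, AlgHom.comp_assoc, AlgHom.comp_assoc, hg]
    calc (Algebra.TensorProduct.map g g).comp ((Bialgebra.comulAlgHom k B).comp q')
        = (Algebra.TensorProduct.map (g.comp q') (g.comp q')).comp
            (Bialgebra.comulAlgHom k A) := by
          rw [Algebra.TensorProduct.map_comp, AlgHom.comp_assoc]
          exact congrArg _ (BialgHomClass.map_comp_comulAlgHom q).symm
      _ = (Bialgebra.comulAlgHom k C).comp p' := by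
          rw [hg]
          exact BialgHomClass.map_comp_comulAlgHom p
  exact ⟨BialgHom.ofAlgHom g counit_g comul_g, BialgHom.ext (AlgHom.congr_fun hg)⟩

end BialgHom

section HopfKernel

theorem isTwoSided_sSup {A : Type*} [Semiring A] {S : Set (Ideal A)}
    (hS : ∀ J ∈ S, J.IsTwoSided) : (sSup S).IsTwoSided where
  mul_mem_of_left b ha := by
    have h : sSup S ≤ Submodule.comap (LinearMap.toSpanSingleton A A b) (sSup S) :=
      sSup_le fun J hJ a ha =>
        have := hS J hJ
        le_sSup hJ (J.mul_mem_right b ha)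
    exact h ha

variable {k A R : Type*} [CommRing k]

theorem isCoideal_sSup [AddCommGroup A] [Module k A] [CoalgebraStruct k A]
    {S : Set (Submodule k A)} (hS : ∀ J ∈ S, J.IsCoideal) : (sSup S).IsCoideal where
  counit_eq_zero := by
    have h : sSup S ≤ LinearMap.ker (CoalgebraStruct.counit (R := k) (A := A)) :=
      sSup_le fun J hJ _ ha => (hS J hJ).counit_eq_zero ha
    exact h
  map_mkQ_comul_eq_zero := by
    have h : sSup S ≤ LinearMap.ker (TensorProduct.map (sSup S).mkQ (sSup S).mkQ ∘ₗ
        CoalgebraStruct.comul) := sSup_le fun J hJ a ha => by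
      have hJS : (sSup S).mkQ = Submodule.factor (le_sSup hJ) ∘ₗ J.mkQ :=
        (Submodule.factor_comp_mk _).symm
      rw [LinearMap.mem_ker, hJS, TensorProduct.map_comp, LinearMap.comp_apply,
        LinearMap.comp_apply, (hS J hJ).map_mkQ_comul_eq_zero ha, map_zero]
    exact h

variable [Ring A] [HopfAlgebra k A] [Ring R] [Algebra k R]

theorem isHopfIdeal_sSup {S : Set (Ideal A)} (hS : ∀ J ∈ S, J.IsHopfIdeal k) :
    (sSup S).IsHopfIdeal k where
  toIsCoideal := by
    rw [Submodule.restrictScalars_sSup]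
    exact isCoideal_sSup (Set.forall_mem_image.2 fun J hJ => (hS J hJ).toIsCoideal)
  antipode_mem := by
    have h : (sSup S).restrictScalars k ≤
        ((sSup S).restrictScalars k).comap (HopfAlgebraStruct.antipode k) := by
      nth_rw 1 [Submodule.restrictScalars_sSup]
      exact sSup_le (Set.forall_mem_image.2 fun J hJ a ha =>
        le_sSup (a := J) hJ ((hS J hJ).antipode_mem ha))
    exact h

/-- The largest two-sided Hopf ideal contained in the kernel of an algebra map `ρ`. Over a field,
the quotient by it is the Hopf image of `ρ`. -/
def hopfKernel (ρ : A →ₐ[k] R) : Ideal A :=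
  sSup {J | J.IsTwoSided ∧ J.IsHopfIdeal k ∧ J ≤ RingHom.ker ρ}

instance (ρ : A →ₐ[k] R) : (hopfKernel ρ).IsTwoSided := isTwoSided_sSup fun _ hJ => hJ.1

instance (ρ : A →ₐ[k] R) : (hopfKernel ρ).IsHopfIdeal k := isHopfIdeal_sSup fun _ hJ => hJ.2.1

theorem hopfKernel_le_ker (ρ : A →ₐ[k] R) : hopfKernel ρ ≤ RingHom.ker ρ :=
  sSup_le fun _ hJ => hJ.2.2

end HopfKernel

section HopfImage

variable {k A B L R : Type*} [Field k] [Ring A] [HopfAlgebra k A] [Ring B] [HopfAlgebra k B]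
  [Ring L] [HopfAlgebra k L] [Ring R] [Algebra k R] {ρ : A →ₐ[k] R}

theorem ker_le_hopfKernel {q : A →ₐc[k] L} {φ : L →ₐ[k] R} (hφ : φ.comp (q : A →ₐ[k] L) = ρ) :
    RingHom.ker q ≤ hopfKernel ρ :=
  le_sSup ⟨inferInstance, isHopfIdeal_ker q, fun a ha => by
    rw [RingHom.mem_ker] at ha ⊢
    rw [← hφ]
    exact (congrArg φ ha).trans (map_zero φ)⟩

theorem ker_mkBialgHom_hopfKernel (ρ : A →ₐ[k] R) :
    RingHom.ker (Bialgebra.Quotient.mkBialgHom (R := k) (hopfKernel ρ)) = hopfKernel ρ :=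
  Ideal.mk_ker

theorem exists_isFactorization_hopfKernel (ρ : A →ₐ[k] R) : ∃ φ : A ⧸ hopfKernel ρ →ₐ[k] R,
    IsFactorization ρ (Bialgebra.Quotient.mkBialgHom (hopfKernel ρ)) φ :=
  ⟨Ideal.Quotient.liftₐ _ ρ (hopfKernel_le_ker ρ), Ideal.Quotient.mk_surjective,
    AlgHom.ext fun _ => rfl⟩

theorem IsFactorization.isHopfImage {p : A →ₐc[k] B} {ψ : B →ₐ[k] R} (hp : IsFactorization ρ p ψ)
    (h : hopfKernel ρ ≤ RingHom.ker p) : IsHopfImage.{w} ρ p ψ := by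
  refine ⟨hp, fun L _ _ q φ hq => ?_⟩
  obtain ⟨f, hf⟩ := exists_bialgHom_comp_eq hq.1 ((ker_le_hopfKernel hq.2).trans h)
  have hf' : (f : L →ₐ[k] B).comp (q : A →ₐ[k] L) = p := AlgHom.ext (BialgHom.congr_fun hf)
  refine ⟨f, ⟨hf, ?_⟩, fun g hg => ?_⟩
  · rw [← AlgHom.cancel_right (f := (q : A →ₐ[k] L)) hq.1, AlgHom.comp_assoc, hf', hp.2, hq.2]
  · refine BialgHom.ext (hq.1.forall.2 fun a => ?_)
    exact BialgHom.congr_fun (hg.1.trans hf.symm) a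

theorem IsInnerFaithful.hopfKernel_eq_bot (hρ : IsInnerFaithful ρ) : hopfKernel ρ = ⊥ := by
  obtain ⟨φ, hφ⟩ := exists_isFactorization_hopfKernel ρ
  obtain ⟨f, ⟨hf, -⟩, -⟩ := hρ.2 _ _ φ hφ
  refine (Submodule.eq_bot_iff _).2 fun a ha => ?_
  calc a = f (Bialgebra.Quotient.mkBialgHom (hopfKernel ρ) a) := (BialgHom.congr_fun hf a).symm
    _ = 0 := by rw [Bialgebra.Quotient.mkBialgHom_apply, Ideal.Quotient.eq_zero_iff_mem.2 ha,
      map_zero]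

theorem IsInnerFaithful.injective (hρ : IsInnerFaithful ρ) {q : A →ₐc[k] L} {φ : L →ₐ[k] R}
    (hφ : φ.comp (q : A →ₐ[k] L) = ρ) : Function.Injective q :=
  (RingHom.injective_iff_ker_eq_bot q).2
    (le_bot_iff.1 (hρ.hopfKernel_eq_bot ▸ ker_le_hopfKernel hφ))

end HopfImage

theorem linearIndependent_of_forall_apply_eq_smul {k V α ι : Type*} [Field k] [AddCommGroup V]
    [Module k V] {v : ι → V} (hv : ∀ i, v i ≠ 0) {T : α → Module.End k V} {χ : ι → α → k}
    (hχ : Function.Injective χ) (hT : ∀ a i, T a (v i) = χ i a • v i) :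
    LinearIndependent k v := by
  -- On words in the operators `T a` the eigenvalues become characters of a free monoid, so that
  -- Dedekind's theorem applies although the operators need not commute.
  let ψ (i : ι) : FreeMonoid α →* k := FreeMonoid.lift (χ i)
  have hψ : LinearIndependent k fun i => (ψ i : FreeMonoid α → k) :=
    (linearIndependent_monoidHom _ k).comp ψ (FreeMonoid.lift.injective.comp hχ)
  have lift_apply (w : FreeMonoid α) (i : ι) : FreeMonoid.lift T w (v i) = ψ i w • v i := by
    induction w using FreeMonoid.inductionOn' with
    | one => simp
    | of_mul a w ih => simp [ψ, ih, hT, mul_smul, smul_comm (χ i a)]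
  rw [linearIndependent_iff']
  intro s g hg i hi
  obtain ⟨f, hf⟩ := Module.Projective.exists_dual_eq_one k (hv i)
  have relation : ∑ m ∈ s, (g m * f (v m)) • (ψ m : FreeMonoid α → k) = 0 := by
    ext w
    calc (∑ m ∈ s, (g m * f (v m)) • (ψ m : FreeMonoid α → k)) w
        = f (FreeMonoid.lift T w (∑ m ∈ s, g m • v m)) := by
          simp [lift_apply, mul_assoc, mul_comm (f _)]
      _ = 0 := by rw [hg, map_zero, map_zero]
  simpa [hf] using linearIndependent_iff'.1 hψ s _ relation i hi

namespace CrossedDatum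

variable {k Q H : Type*} [Field k] [Group Q] [Group H] [Fintype H] [DecidableEq H]
  (D : CrossedDatum k Q H)

theorem incl_delta (h : H) : D.incl (FunAlg.delta k h) = D.basis 1 h := by
  simp [incl_apply, tmul]

/-- The embedding `k^H → D.Alg`, `f ↦ 1 # f`, as a map of bialgebras. -/
def inclBialgHom : FunAlg k H →ₐc[k] D.Alg :=
  BialgHom.ofAlgHom D.incl
    (AlgHom.toLinearMap_injective <| FunAlg.lin_ext fun h => by
      change CoalgebraStruct.counit (R := k) (D.incl (FunAlg.delta k h)) =
        FunAlg.counitLin k H (FunAlg.delta k h)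
      rw [incl_delta, counit_basis, FunAlg.counitLin_delta])
    (AlgHom.toLinearMap_injective <| FunAlg.lin_ext fun h => by
      change TensorProduct.map D.incl.toLinearMap D.incl.toLinearMap
          (CoalgebraStruct.comul (R := k) (FunAlg.delta k h)) =
        CoalgebraStruct.comul (R := k) (D.incl (FunAlg.delta k h))
      rw [incl_delta, comul_basis, FunAlg.comul_delta, map_sum, ← Equiv.sum_comp (Equiv.inv H)]
      simp [incl_delta, D.τ_unit])

theorem inclBialgHom_delta (h : H) : D.inclBialgHom (FunAlg.delta k h) = D.basis 1 h :=
  D.incl_delta h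

end CrossedDatum

namespace SmashCoproduct

variable {k Γ H : Type*} [Field k] [Group Γ] [Group H] [DecidableEq H] [MulDistribMulAction H Γ]

theorem basis_mul_basis_same (r s : Γ) (h : H) :
    basis k r h * basis k s h = basis k (r * s) h := by
  rw [basis_mul_basis, if_pos rfl]

theorem basis_one_mul_basis (r : Γ) (h : H) : basis k 1 h * basis k r h = basis k r h := by
  rw [basis_mul_basis_same, one_mul]

variable [Fintype H]

theorem tmul_mul_basis (r s : Γ) (f : FunAlg k H) (h : H) :
    tmul r f * basis k s h = f h • basis k (r * s) h := by
  simp [tmul, CrossedDatum.tmul, Finset.sum_mul, basis_mul_basis]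

theorem tmul_mul_tmul (r s : Γ) (f g : FunAlg k H) :
    tmul r f * tmul s g = tmul (r * s) (f * g) := by
  change tmul r f * ∑ h, g h • basis k s h = ∑ h, (f * g) h • basis k (r * s) h
  rw [Finset.mul_sum]
  refine Finset.sum_congr rfl fun h _ => ?_
  rw [mul_smul_comm, tmul_mul_basis, smul_smul, FunAlg.mul_apply, mul_comm]

theorem map_tmul_eq_iff {B : Type*} [Ring B] [Algebra k B] (φ : SmashCoproduct k Γ H →ₐ[k] B)
    (r : Γ) (f : FunAlg k H) :
    φ (tmul r 1) = φ (tmul 1 f) ↔ ∀ h, φ (basis k r h) = f h • φ (basis k 1 h) := by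
  constructor
  · intro hr h
    have hrh := congrArg (· * φ (basis k 1 h)) hr
    simpa only [← map_mul, tmul_mul_basis, mul_one, FunAlg.one_apply, one_smul, map_smul] using hrh
  · intro hr
    simp only [tmul, CrossedDatum.tmul, map_sum, map_smul, FunAlg.one_apply, one_smul, hr]

end SmashCoproduct

namespace QuotientDatum

variable {k Γ H : Type*} [Field k] [Group Γ] [Group H] [MulDistribMulAction H Γ]
  {D : QuotientDatum k Γ H} (j : D.Sec)

instance : Nonempty D.Sec := by
  classical
  exact ⟨{
    toFun x := if x = 1 then 1 else x.out
    mk_toFun x := by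
      split_ifs with h
      · rw [h, QuotientGroup.mk_one]
      · exact x.out_eq'
    map_one := if_pos rfl }⟩

theorem gauge_sec (x : Γ ⧸ D.N) (h : H) : gauge j (j x) h = 1 := by
  have hx : j x * (j (j x : Γ ⧸ D.N))⁻¹ = 1 := by rw [Sec.mk_apply, mul_inv_cancel]
  rw [gauge, phi_congr hx, phi_one, FunAlg.one_apply]

theorem gauge_of_mem {r : Γ} (hr : r ∈ D.N) : gauge j r = D.phi r hr := by
  refine phi_congr ?_ _
  rw [(QuotientGroup.eq_one_iff r).2 hr, j.map_one, inv_one, mul_one]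

variable [Fintype H] [DecidableEq H]

/-- The linear map `q : r # δ_h ↦ u(r) # δ_h Φ(r ju(r)⁻¹)`. -/
def projLin : SmashCoproduct k Γ H →ₗ[k] D.QuotientHopf j :=
  (smashDatum k Γ H).lift fun r h => gauge j r h • QuotientHopf.basis j (r : Γ ⧸ D.N) h

theorem projLin_basis (r : Γ) (h : H) : projLin j (SmashCoproduct.basis k r h) =
    gauge j r h • QuotientHopf.basis j (r : Γ ⧸ D.N) h := CrossedDatum.lift_basis _ _ _ _

theorem projLin_one : projLin j 1 = 1 := by
  rw [CrossedDatum.one_def, CrossedDatum.one_def, map_sum]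
  refine Finset.sum_congr rfl fun h _ => ?_
  rw [projLin_basis, gauge_one, one_smul]
  rfl

theorem projLin_mul (a b : SmashCoproduct k Γ H) :
    projLin j (a * b) = projLin j a * projLin j b := by
  suffices h : (LinearMap.mul k (SmashCoproduct k Γ H)).compr₂ (projLin j) =
      (LinearMap.mul k (D.QuotientHopf j)).compl₁₂ (projLin j) (projLin j) from
    LinearMap.congr_fun₂ h a b
  refine CrossedDatum.lin_ext fun r h => CrossedDatum.lin_ext fun s l => ?_
  simp only [LinearMap.compr₂_apply, LinearMap.mul_apply', LinearMap.compl₁₂_apply,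
    projLin_basis, SmashCoproduct.basis_mul_basis, smul_mul_smul_comm]
  rw [CrossedDatum.basis_mul]
  split_ifs with hl
  · subst hl
    rw [projLin_basis, smul_smul, ← gauge_σ]
    rfl
  · rw [map_zero, smul_zero]

/-- `projLin` as an algebra map. -/
def projAlg : SmashCoproduct k Γ H →ₐ[k] D.QuotientHopf j :=
  AlgHom.ofLinearMap (projLin j) (projLin_one j) (projLin_mul j)

theorem projAlg_basis (r : Γ) (h : H) : projAlg j (SmashCoproduct.basis k r h) =
    gauge j r h • QuotientHopf.basis j (r : Γ ⧸ D.N) h := projLin_basis j r h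

theorem counit_comp_projAlg : (Bialgebra.counitAlgHom k (D.QuotientHopf j)).comp (projAlg j) =
    Bialgebra.counitAlgHom k (SmashCoproduct k Γ H) := by
  refine AlgHom.toLinearMap_injective (CrossedDatum.lin_ext fun r h => ?_)
  change CoalgebraStruct.counit (R := k) (projAlg j (SmashCoproduct.basis k r h)) =
    CoalgebraStruct.counit (R := k) (SmashCoproduct.basis k r h)
  rw [projAlg_basis, map_smul, QuotientHopf.counit_basis, SmashCoproduct.counit_basis]
  split_ifs with hh
  · rw [hh, gauge_at_one, one_smul]
  · rw [smul_zero]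

theorem map_projAlg_comp_comul :
    (Algebra.TensorProduct.map (projAlg j) (projAlg j)).comp
        (Bialgebra.comulAlgHom k (SmashCoproduct k Γ H)) =
      (Bialgebra.comulAlgHom k (D.QuotientHopf j)).comp (projAlg j) := by
  refine AlgHom.toLinearMap_injective (CrossedDatum.lin_ext fun r h => ?_)
  change TensorProduct.map (projAlg j).toLinearMap (projAlg j).toLinearMap
      (CoalgebraStruct.comul (R := k) (SmashCoproduct.basis k r h)) =
    CoalgebraStruct.comul (R := k) (projAlg j (SmashCoproduct.basis k r h))
  rw [SmashCoproduct.comul_basis, projAlg_basis, map_smul, CrossedDatum.comul_basis,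
    map_sum, Finset.smul_sum]
  refine Finset.sum_congr rfl fun l _ => ?_
  rw [TensorProduct.map_tmul, AlgHom.toLinearMap_apply, AlgHom.toLinearMap_apply, projAlg_basis,
    projAlg_basis, TensorProduct.smul_tmul_smul, TensorProduct.tmul_smul, smul_smul, gauge_τ]
  rfl

/-- The canonical map `q : k[Γ] ⋊ k^H → k[Γ/N] ⋊_Φ k^H`, `r # δ_h ↦ u(r) # δ_h Φ(r ju(r)⁻¹)`, of
Hopf algebras. -/
def proj : SmashCoproduct k Γ H →ₐc[k] D.QuotientHopf j :=
  BialgHom.ofAlgHom (projAlg j) (counit_comp_projAlg j) (map_projAlg_comp_comul j)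

theorem proj_basis (r : Γ) (h : H) : proj j (SmashCoproduct.basis k r h) =
    gauge j r h • QuotientHopf.basis j (r : Γ ⧸ D.N) h := projLin_basis j r h

theorem proj_surjective : Function.Surjective (proj j) := by
  suffices h : LinearMap.range (projLin j) = ⊤ from LinearMap.range_eq_top.1 h
  rw [← Submodule.ker_mkQ (LinearMap.range _), LinearMap.ker_eq_top]
  refine CrossedDatum.lin_ext fun x h => (Submodule.Quotient.mk_eq_zero _).2 ?_
  exact ⟨SmashCoproduct.basis k (j x) h, by
    rw [projLin_basis, gauge_sec, one_smul, Sec.mk_apply]⟩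

theorem mem_compatibleData_proj :
    D ∈ compatibleData (proj j : SmashCoproduct k Γ H →ₐ[k] D.QuotientHopf j) := fun r hr => by
  refine (SmashCoproduct.map_tmul_eq_iff _ r _).2 fun h => ?_
  change proj j _ = _ • proj j _
  rw [proj_basis, proj_basis, gauge_one, one_smul, (QuotientGroup.eq_one_iff r).2 hr,
    gauge_of_mem j hr, QuotientGroup.mk_one]

theorem mem_compatibleData_of_ker_proj_le {B : Type*} [Ring B] [Algebra k B]
    {φ : SmashCoproduct k Γ H →ₐ[k] B} (h : RingHom.ker (proj j) ≤ RingHom.ker φ) :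
    D ∈ compatibleData φ := by
  intro r hr
  rw [← sub_eq_zero, ← map_sub]
  refine h ?_
  rw [RingHom.mem_ker, map_sub, sub_eq_zero]
  exact mem_compatibleData_proj j r hr

section Compatible

variable {R : Type*} [Ring R] [Algebra k R] {ρ : SmashCoproduct k Γ H →ₐ[k] R}

theorem map_mul_basis_of_mem_compatibleData (hD : D ∈ compatibleData ρ) {r : Γ} (hr : r ∈ D.N)
    (s : Γ) (h : H) :
    ρ (SmashCoproduct.basis k (r * s) h) = D.phi r hr h • ρ (SmashCoproduct.basis k s h) := by
  rw [← SmashCoproduct.basis_mul_basis_same, map_mul,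
    (SmashCoproduct.map_tmul_eq_iff ρ r _).1 (hD r hr) h, smul_mul_assoc, ← map_mul,
    SmashCoproduct.basis_one_mul_basis]

/-- The linear map `x # δ_h ↦ ρ(j(x) # δ_h)`. -/
def factorLin (ρ : SmashCoproduct k Γ H →ₐ[k] R) : D.QuotientHopf j →ₗ[k] R :=
  (D.crossed j).lift fun x h => ρ (SmashCoproduct.basis k (j x) h)

theorem factorLin_basis (x : Γ ⧸ D.N) (h : H) :
    factorLin j ρ (QuotientHopf.basis j x h) = ρ (SmashCoproduct.basis k (j x) h) :=
  CrossedDatum.lift_basis _ _ _ _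

theorem factorLin_proj (hD : D ∈ compatibleData ρ) (a : SmashCoproduct k Γ H) :
    factorLin j ρ (proj j a) = ρ a := by
  suffices h : factorLin j ρ ∘ₗ projLin j = ρ.toLinearMap from LinearMap.congr_fun h a
  refine CrossedDatum.lin_ext fun r h => ?_
  change factorLin j ρ (projLin j (SmashCoproduct.basis k r h)) = ρ (SmashCoproduct.basis k r h)
  rw [projLin_basis, map_smul, factorLin_basis, gauge,
    ← map_mul_basis_of_mem_compatibleData hD (j.mem r), inv_mul_cancel_right]

/-- The algebra map `x # δ_h ↦ ρ(j(x) # δ_h)` attached to `(N, Φ) ∈ E(ρ)`. -/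
def factor (hD : D ∈ compatibleData ρ) : D.QuotientHopf j →ₐ[k] R :=
  AlgHom.ofLinearMap (factorLin j ρ)
    (by rw [← map_one (proj j), factorLin_proj j hD, map_one])
    ((proj_surjective j).forall₂.2 fun a b => by
      simp only [← map_mul (proj j), factorLin_proj j hD, map_mul ρ])

theorem isFactorization_proj (hD : D ∈ compatibleData ρ) :
    IsFactorization ρ (proj j) (factor j hD) :=
  ⟨proj_surjective j, AlgHom.ext (factorLin_proj j hD)⟩

end Compatible

end QuotientDatum

namespace SmashCoproduct

variable {k Γ H L : Type*} [Field k] [Group Γ] [Group H] [Fintype H] [DecidableEq H]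
  [MulDistribMulAction H Γ] [Ring L] [HopfAlgebra k L]

theorem basis_tmul_basis_mul_comul (r : Γ) (a b h : H) :
    (basis k 1 a ⊗ₜ[k] basis k 1 b) * CoalgebraStruct.comul (R := k) (basis k r h) =
      if h = a * b then basis k r a ⊗ₜ[k] basis k (a⁻¹ • r) b else 0 := by
  rw [comul_basis, Finset.mul_sum, Finset.sum_eq_single a⁻¹]
  · rw [Algebra.TensorProduct.tmul_mul_tmul, inv_inv, basis_one_mul_basis, basis_mul_basis, one_mul]
    simp only [eq_inv_mul_iff_mul_eq, eq_comm (a := a * b), TensorProduct.tmul_ite]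
  · intro l _ hl
    rw [Algebra.TensorProduct.tmul_mul_tmul, basis_mul_basis,
      if_neg fun h => hl (inv_eq_iff_eq_inv.1 h.symm), TensorProduct.zero_tmul]
  · exact fun h => (h (Finset.mem_univ _)).elim

variable (q : SmashCoproduct k Γ H →ₐc[k] L)

/-- The component of the coproduct of `L` cut out by the images under `q` of the idempotents
`1 # δ_a` and `1 # δ_b`. -/
def comulComponent (a b : H) : L →ₗ[k] L ⊗[k] L :=
  LinearMap.mulLeft k (q (basis k 1 a) ⊗ₜ[k] q (basis k 1 b)) ∘ₗ CoalgebraStruct.comul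

theorem comulComponent_map_basis (r : Γ) (a b h : H) :
    comulComponent q a b (q (basis k r h)) =
      if h = a * b then q (basis k r a) ⊗ₜ[k] q (basis k (a⁻¹ • r) b) else 0 := by
  let qq := Algebra.TensorProduct.map (q : SmashCoproduct k Γ H →ₐ[k] L)
    (q : SmashCoproduct k Γ H →ₐ[k] L)
  have comul_map : qq (CoalgebraStruct.comul (R := k) (basis k r h)) =
      CoalgebraStruct.comul (R := k) (q (basis k r h)) :=
    CoalgHomClass.map_comp_comul_apply q _
  have h := congrArg qq (basis_tmul_basis_mul_comul (k := k) r a b h)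
  rw [map_mul, comul_map, apply_ite qq, map_zero] at h
  exact h

/-- The homomorphism `r ↦ q(r # 1)` to the units of `L`. -/
def groupUnits : Γ →* Lˣ :=
  MonoidHom.toHomUnits
    { toFun := fun r => q (tmul r 1)
      map_one' := map_one q
      map_mul' := fun r s => by rw [← map_mul, tmul_mul_tmul, mul_one] }

/-- The homomorphism `f ↦ q(1 # f)` from the units of `k^H` to those of `L`. -/
def functionUnits : (FunAlg k H)ˣ →* Lˣ :=
  Units.map (q.comp (smashDatum k Γ H).inclBialgHom : FunAlg k H →* L)

/-- The subgroup `N` of `Γ` read off from `q`: all `r` such that `q(r # 1) = q(1 # f)` for some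
unit `f` of `k^H`. -/
def scalarSubgroup : Subgroup Γ := (functionUnits q).range.comap (groupUnits q)

variable {q}

theorem map_basis_conj {r : Γ} {h : H} {c : k} (hr : q (basis k r h) = c • q (basis k 1 h))
    (s : Γ) : q (basis k (s * r * s⁻¹) h) = c • q (basis k 1 h) := by
  rw [← basis_mul_basis_same, ← basis_mul_basis_same, map_mul, map_mul, hr, mul_smul_comm,
    smul_mul_assoc, ← map_mul, ← map_mul, basis_mul_basis_same, basis_mul_basis_same, mul_one,
    mul_inv_cancel]

theorem map_basis_ne_zero (hq : Function.Injective (q.comp (smashDatum k Γ H).inclBialgHom))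
    (r : Γ) (h : H) : q (basis k r h) ≠ 0 := by
  intro hr
  have map_delta : q.comp (smashDatum k Γ H).inclBialgHom (FunAlg.delta k h) = 0 := by
    rw [BialgHom.comp_apply, CrossedDatum.inclBialgHom_delta]
    calc q (basis k 1 h) = q (basis k r⁻¹ h) * q (basis k r h) := by
          rw [← map_mul, basis_mul_basis_same, inv_mul_cancel]
      _ = 0 := by rw [hr, mul_zero]
  have delta_eq_zero := (map_eq_zero_iff _ hq).1 map_delta
  simpa using congrArg (fun f : FunAlg k H => f h) delta_eq_zero

theorem smul_map_basis_inv_smul (hq : Function.Injective (q.comp (smashDatum k Γ H).inclBialgHom))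
    {r : Γ} {a b : H} {c d : k} (hc : q (basis k r a) = c • q (basis k 1 a))
    (hd : q (basis k r (a * b)) = d • q (basis k 1 (a * b))) :
    c • q (basis k (a⁻¹ • r) b) = d • q (basis k 1 b) := by
  obtain ⟨f, hf⟩ := Module.Projective.exists_dual_eq_one k (map_basis_ne_zero hq 1 a)
  have h := congrArg (TensorProduct.lid k L ∘ f.rTensor L ∘ comulComponent q a b) hd
  simpa [comulComponent_map_basis, hc, hf] using h

theorem mem_scalarSubgroup_iff (hq : Function.Injective (q.comp (smashDatum k Γ H).inclBialgHom))
    {r : Γ} : r ∈ scalarSubgroup q ↔ ∀ h, ∃ c : k, q (basis k r h) = c • q (basis k 1 h) := by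
  constructor
  · rintro ⟨f, hf⟩ h
    exact ⟨_, (map_tmul_eq_iff (q : SmashCoproduct k Γ H →ₐ[k] L) r f).1
      (congrArg Units.val hf).symm h⟩
  · intro hr
    choose c hc using hr
    have c_ne_zero (h : H) : c h ≠ 0 := fun h0 =>
      map_basis_ne_zero hq r h (by rw [hc, h0, zero_smul])
    let f : (FunAlg k H)ˣ :=
      ⟨FunAlg.mk c, FunAlg.mk fun h => (c h)⁻¹, by ext h; simp [c_ne_zero],
        by ext h; simp [c_ne_zero]⟩
    exact ⟨f, Units.ext ((map_tmul_eq_iff (q : SmashCoproduct k Γ H →ₐ[k] L) r f).2 hc).symm⟩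

variable (hq : Function.Injective (q.comp (smashDatum k Γ H).inclBialgHom))

/-- The homomorphism `Φ : N → (k^H)ˣ` with `q(r # 1) = q(1 # Φ(r))`. -/
def scalarHom : scalarSubgroup q →* (FunAlg k H)ˣ :=
  (MonoidHom.ofInjective (f := functionUnits q) (Units.map_injective hq)).symm.toMonoidHom.comp
    ((groupUnits q).subgroupComap (functionUnits q).range)

theorem map_tmul_scalarHom (r : scalarSubgroup q) :
    q (tmul r 1) = q (tmul 1 (scalarHom hq r : FunAlg k H)) := by
  have h : functionUnits q (scalarHom hq r) = groupUnits q r :=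
    congrArg Subtype.val ((MonoidHom.ofInjective (f := functionUnits q)
      (Units.map_injective hq)).apply_symm_apply _)
  exact (congrArg Units.val h).symm

theorem map_basis_scalarHom (r : scalarSubgroup q) (h : H) :
    q (basis k r h) = (scalarHom hq r : FunAlg k H) h • q (basis k 1 h) :=
  (map_tmul_eq_iff (q : SmashCoproduct k Γ H →ₐ[k] L) r _).1 (map_tmul_scalarHom hq r) h

theorem scalarHom_eq_of_map_basis (r : scalarSubgroup q) {h : H} {c : k}
    (hr : q (basis k r h) = c • q (basis k 1 h)) : (scalarHom hq r : FunAlg k H) h = c :=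
  smul_left_injective k (map_basis_ne_zero hq 1 h) ((map_basis_scalarHom hq r h).symm.trans hr)

theorem scalarHom_ne_zero (r : scalarSubgroup q) (h : H) :
    (scalarHom hq r : FunAlg k H) h ≠ 0 := fun h0 =>
  map_basis_ne_zero hq r h (by rw [map_basis_scalarHom hq, h0, zero_smul])

theorem map_basis_inv_smul (r : scalarSubgroup q) (a b : H) :
    q (basis k (a⁻¹ • (r : Γ)) b) = ((scalarHom hq r : FunAlg k H) (a * b) /
      (scalarHom hq r : FunAlg k H) a) • q (basis k 1 b) := by
  rw [div_eq_inv_mul, mul_smul, eq_inv_smul_iff₀ (scalarHom_ne_zero hq r a)]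
  exact smul_map_basis_inv_smul hq (map_basis_scalarHom hq r a) (map_basis_scalarHom hq r _)

/-- The quotient datum `(N, Φ)` of a bialgebra map `q` that is injective on `k^H`. -/
def quotientDatum : QuotientDatum k Γ H where
  N := scalarSubgroup q
  normal := ⟨fun r hr s => (mem_scalarSubgroup_iff hq).2 fun h =>
    ⟨_, map_basis_conj (map_basis_scalarHom hq ⟨r, hr⟩ h) s⟩⟩
  stable l r hr := (mem_scalarSubgroup_iff hq).2 fun h =>
    ⟨_, by simpa only [inv_inv] using map_basis_inv_smul hq ⟨r, hr⟩ l⁻¹ h⟩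
  Φ := scalarHom hq
  Φ_mul r l h := by
    rw [scalarHom_eq_of_map_basis hq ⟨l⁻¹ • (r : Γ), _⟩ (map_basis_inv_smul hq r l h),
      div_mul_cancel₀ _ (scalarHom_ne_zero hq r l)]
  Φ_conj r s := Units.ext <| FunAlg.ext fun h =>
    (scalarHom_eq_of_map_basis hq _ (map_basis_conj (map_basis_scalarHom hq r h) s)).symm

theorem isGreatest_quotientDatum :
    IsGreatest (compatibleData (q : SmashCoproduct k Γ H →ₐ[k] L)) (quotientDatum hq) := by
  refine ⟨fun r hr => map_tmul_scalarHom hq ⟨r, hr⟩, fun D hD => ?_⟩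
  have map_basis_phi (r : D.N) (h : H) :
      q (basis k r h) = D.phi r r.2 h • q (basis k 1 h) :=
    (map_tmul_eq_iff (q : SmashCoproduct k Γ H →ₐ[k] L) r _).1 (hD r r.2) h
  exact ⟨fun r hr => (mem_scalarSubgroup_iff hq).2 fun h => ⟨_, map_basis_phi ⟨r, hr⟩ h⟩,
    fun r => Units.ext <| FunAlg.ext fun h => scalarHom_eq_of_map_basis hq _ (map_basis_phi r h)⟩

theorem mem_quotientDatum_of_map_basis_one {r : Γ} (hr : q (basis k r 1) = q (basis k 1 1)) :
    r ∈ (quotientDatum hq).N := by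
  refine (mem_scalarSubgroup_iff hq).2 fun h => ?_
  obtain ⟨f, hf⟩ := Module.Projective.exists_dual_eq_one k (map_basis_ne_zero hq (h⁻¹ • r) h⁻¹)
  have component_eq := congrArg (TensorProduct.rid k L ∘ f.lTensor L ∘ comulComponent q h h⁻¹) hr
  exact ⟨f (q (basis k 1 h⁻¹)), by simpa [comulComponent_map_basis, hf] using component_eq⟩

theorem map_basis_one_injective {ι : Type*} {r : ι → Γ}
    (hr : Function.Injective fun i => (r i : Γ ⧸ (quotientDatum hq).N)) :
    Function.Injective fun i => q (basis k (r i) 1) := by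
  intro i i' h
  have map_div : q (basis k (r i / r i') 1) = q (basis k 1 1) := by
    have h := congrArg (· * q (basis k (r i')⁻¹ 1)) h
    simpa only [← map_mul, basis_mul_basis_same, ← div_eq_mul_inv, div_self'] using h
  exact hr (QuotientGroup.eq_iff_div_mem.2 (mem_quotientDatum_of_map_basis_one hq map_div))

theorem linearIndependent_map_basis {ι : Type*} {r : ι → Γ}
    (hr : Function.Injective fun i => (r i : Γ ⧸ (quotientDatum hq).N)) :
    LinearIndependent k fun p : ι × H => q (basis k (r p.1) p.2) := by
  let T (a : Module.Dual k L × H) : Module.End k L :=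
    (TensorProduct.lid k L).toLinearMap ∘ₗ a.1.rTensor L ∘ₗ comulComponent q 1 a.2
  let χ (p : ι × H) (a : Module.Dual k L × H) : k :=
    if p.2 = a.2 then a.1 (q (basis k (r p.1) 1)) else 0
  have eigen (a : Module.Dual k L × H) (p : ι × H) :
      T a (q (basis k (r p.1) p.2)) = χ p a • q (basis k (r p.1) p.2) := by
    by_cases h : p.2 = a.2 <;> simp [T, χ, comulComponent_map_basis, h]
  refine linearIndependent_of_forall_apply_eq_smul (fun p => map_basis_ne_zero hq _ _)
    (T := T) (χ := χ) ?_ eigen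
  rintro ⟨i, l⟩ ⟨i', l'⟩ hχ
  have apply_eq (f : Module.Dual k L) :
      f (q (basis k (r i) 1)) = if l' = l then f (q (basis k (r i') 1)) else 0 := by
    simpa [χ] using congrFun hχ (f, l)
  obtain rfl : l' = l := by
    obtain ⟨f, hf⟩ := Module.Projective.exists_dual_eq_one k (map_basis_ne_zero hq (r i) 1)
    by_contra h
    simpa [hf, h] using apply_eq f
  obtain rfl : i = i' := map_basis_one_injective hq hr <| by
    refine sub_eq_zero.1 ((Module.forall_dual_apply_eq_zero_iff k _).1 fun f => ?_)
    rw [map_sub, apply_eq, if_pos rfl, sub_self]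
  rfl

theorem ker_le_ker_proj (j : (quotientDatum hq).Sec) :
    RingHom.ker q ≤ RingHom.ker (QuotientDatum.proj j) := by
  have factorLin_injective : Function.Injective
      (QuotientDatum.factorLin j (q : SmashCoproduct k Γ H →ₐ[k] L)) :=
    linearIndependent_map_basis hq (r := j) fun x y hxy => by simpa using hxy
  intro a ha
  rw [RingHom.mem_ker] at ha ⊢
  apply factorLin_injective
  rw [QuotientDatum.factorLin_proj j (isGreatest_quotientDatum hq).1, map_zero]
  exact ha

end SmashCoproduct

namespace SmashCoproduct

variable {k Γ H R : Type*} [Field k] [Group Γ] [Group H] [Fintype H] [DecidableEq H]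
  [MulDistribMulAction H Γ] [Ring R] [Algebra k R] {ρ : SmashCoproduct k Γ H →ₐ[k] R}

theorem exists_isGreatest_compatibleData (hρ : IsInnerFaithful (ρ.comp (incl k Γ H))) :
    ∃ D, IsGreatest (compatibleData ρ) D ∧
      ∀ j : D.Sec, hopfKernel ρ ≤ RingHom.ker (QuotientDatum.proj j) := by
  obtain ⟨φ, -, hφ⟩ := exists_isFactorization_hopfKernel ρ
  let p : SmashCoproduct k Γ H →ₐc[k] SmashCoproduct k Γ H ⧸ hopfKernel ρ :=
    Bialgebra.Quotient.mkBialgHom (hopfKernel ρ)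
  have ker_p : RingHom.ker p = hopfKernel ρ := ker_mkBialgHom_hopfKernel ρ
  have map_p (a : SmashCoproduct k Γ H) : φ (p a) = ρ a := AlgHom.congr_fun hφ a
  have hp : Function.Injective (p.comp (smashDatum k Γ H).inclBialgHom) :=
    hρ.injective (φ := φ) (AlgHom.ext fun f => map_p (incl k Γ H f))
  refine ⟨quotientDatum hp, ⟨fun r hr => ?_, fun D hD => ?_⟩, fun j => ?_⟩
  · rw [← map_p, ← map_p]
    exact congrArg φ ((isGreatest_quotientDatum hp).1 r hr)
  · obtain ⟨j⟩ : Nonempty D.Sec := inferInstance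
    refine (isGreatest_quotientDatum hp).2 (QuotientDatum.mem_compatibleData_of_ker_proj_le j ?_)
    exact (ker_le_hopfKernel (QuotientDatum.isFactorization_proj j hD).2).trans ker_p.ge
  · exact ker_p.ge.trans (ker_le_ker_proj hp j)

end SmashCoproduct

end

theorem proposition4p1
    {k : Type*} [Field k] {Γ : Type*} [Group Γ]
    {H : Type*} [Group H] [Fintype H] [DecidableEq H] [MulDistribMulAction H Γ]
    {R : Type*} [Ring R] [Algebra k R]
    (ρ : SmashCoproduct k Γ H →ₐ[k] R)
    (hρ : IsInnerFaithful (ρ.comp (SmashCoproduct.incl k Γ H))) :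
    (∀ D ∈ compatibleData ρ, ∀ j : D.Sec,
      ∃ (q : SmashCoproduct k Γ H →ₐc[k] D.QuotientHopf j) (ρ' : D.QuotientHopf j →ₐ[k] R),
        (∀ (r : Γ) (h : H), q (SmashCoproduct.basis k r h) =
          QuotientDatum.QuotientHopf.tmul j (r : Γ ⧸ D.N)
            (FunAlg.delta k h * D.phi (r * (j (r : Γ ⧸ D.N))⁻¹) (j.mem r))) ∧
        (∀ (x : Γ ⧸ D.N) (h : H), ρ' (QuotientDatum.QuotientHopf.basis j x h) =
          ρ (SmashCoproduct.basis k (j x) h)) ∧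
        IsFactorization ρ q ρ' ∧
        (Maximal (· ∈ compatibleData ρ) D → IsHopfImage.{w} ρ q ρ')) ∧
    ∃ D : QuotientDatum k Γ H, Maximal (· ∈ compatibleData ρ) D := by
  obtain ⟨E, hE, hker⟩ := SmashCoproduct.exists_isGreatest_compatibleData hρ
  refine ⟨fun D hD j => ⟨QuotientDatum.proj j, QuotientDatum.factor j hD, fun r h => ?_,
    QuotientDatum.factorLin_basis j, QuotientDatum.isFactorization_proj j hD, fun hmax => ?_⟩,
    E, hE.maximal⟩
  · rw [QuotientDatum.proj_basis, QuotientDatum.QuotientHopf.tmul_delta]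
    rfl
  · obtain rfl : D = E := hmax.eq_of_le hE.1 (hE.2 hD)
    exact (QuotientDatum.isFactorization_proj j hD).isHopfImage (hker j)
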